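/- Let $\lambda>0$, $\frac{2\lambda}{2\lambda+1}<p\le 1$ and $A>0$. For a set $E\subseteq\mathbb R$ write $|E|_\lambda=\int_E|x|^{2\lambda}\,dx$, and for $x_0\in\mathbb R$, $\delta_0>0$ let $I(x_0,\delta_0)=\{x:|x-x_0|<\delta_0\}$. For an integer $\kappa\ge 2\left\lfloor(2\lambda+1)\frac{1-p}{p}\right\rfloor$, a Lebesgue measurable function $a:\mathbb R\to\mathbb C$ is called a $p_\lambda$-atom (with size constant $A$ and vanishing order $\kappa$) if for some $x_0\in\mathbb R$ and $0<\delta_0<|x_0|/2$: (i) $\|a\|_{L^\infty}\le A\,|I(x_0,\delta_0)|_\lambda^{-1/p}$; (ii) $a$ vanishes almost everywhere outside $I(x_0,\delta_0)$; (iii) $\int_{\mathbb R}t^k a(t)|t|^{2\lambda}\,dt=0$ for $k=0,1,\dots,\kappa$. For $y>0$ the conjugate $\lambda$-Poisson integral of $a$ is $$(a*_\lambda Q_y)(x)=c_\lambda\int_{\mathbb R}a(t)\,(\tau_xQ_y)(-t)\,|t|^{2\lambda}\,dt,\qquad c_\lambda^{-1}=2^{\lambda+1/2}\,\Gamma(\lambda+\tfrac12),$$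 where $$(\tau_xQ_y)(-t)=\frac{\lambda\,\Gamma(\lambda+1/2)}{2^{-\lambda-1/2}\,\pi}\int_0^\pi\frac{(x-t)\,(1+\operatorname{sgn}(xt)\cos\theta)}{\big(y^2+x^2+t^2-2|xt|\cos\theta\big)^{\lambda+1}}\,\sin^{2\lambda-1}\theta\,d\theta .$$ Then there is a constant $C>0$, depending only on $\lambda$, $p$ and $A$ (in particular not on $a$, $x_0$, $\delta_0$, $\kappa$ or $y$), such that for every $p_\lambda$-atom $a$ with size constant $A$ and any vanishing order $\kappa\ge 2\left\lfloor(2\lambda+1)\frac{1-p}{p}\right\rfloor$, and every $y>0$, the function $|(a*_\lambda Q_y)(x)|^p|x|^{2\lambda}$ is integrable on $\mathbb R$ and $$\int_{\mathbb R}|(a*_\lambda Q_y)(x)|^p\,|x|^{2\lambda}\,dx\le C .$$ -/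

import Mathlib

open MeasureTheory

/-- The weighted measure `|E|_λ = ∫_E |x|^{2λ} dx` of a set of reals. -/
noncomputable def dunklVol (lam : ℝ) (E : Set ℝ) : ℝ :=
  ∫ x in E, |x| ^ (2 * lam)

/-- The normalizing constant `c_λ = (2^{λ+1/2} Γ(λ+1/2))⁻¹`. -/
noncomputable def dunklConst (lam : ℝ) : ℝ :=
  ((2 : ℝ) ^ (lam + 1 / 2) * Real.Gamma (lam + 1 / 2))⁻¹

/-- The conjugate `λ`-Poisson kernel `(τ_x Q_y)(-t)`. -/
noncomputable def conjPoissonKernel (lam y x t : ℝ) : ℝ :=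
  lam * Real.Gamma (lam + 1 / 2) / ((2 : ℝ) ^ (-lam - 1 / 2) * Real.pi) *
    ∫ θ in (0 : ℝ)..Real.pi,
      (x - t) * (1 + Real.sign (x * t) * Real.cos θ) /
          (y ^ 2 + x ^ 2 + t ^ 2 - 2 * |x * t| * Real.cos θ) ^ (lam + 1) *
        Real.sin θ ^ (2 * lam - 1)

/-- The conjugate `λ`-Poisson integral
`(f ∗_λ Q_y)(x) = c_λ ∫ f(t) (τ_x Q_y)(-t) |t|^{2λ} dt`. -/
noncomputable def conjPoissonIntegral (lam : ℝ) (f : ℝ → ℂ) (y x : ℝ) : ℂ :=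
  (dunklConst lam : ℂ) *
    ∫ t : ℝ, f t * ((conjPoissonKernel lam y x t * |t| ^ (2 * lam) : ℝ) : ℂ)

/-- `a` is a `p_λ`-atom with size constant `A` and vanishing moments up to order `κ`,
carried by the interval `I(x₀, δ₀) = {x : |x - x₀| < δ₀}`. -/
structure IsDunklAtomOn (lam p A : ℝ) (κ : ℕ) (x₀ δ₀ : ℝ) (a : ℝ → ℂ) : Prop where
  measurable : AEStronglyMeasurable a volume
  radius_pos : 0 < δ₀
  radius_lt : δ₀ < |x₀ / 2|
  size : eLpNorm a ⊤ volume ≤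
    ENNReal.ofReal (A / dunklVol lam (Metric.ball x₀ δ₀) ^ (1 / p))
  support : ∀ᵐ t : ℝ, t ∉ Metric.ball x₀ δ₀ → a t = 0
  order : 2 * ⌊(2 * lam + 1) * ((1 - p) / p)⌋₊ ≤ κ
  moments : ∀ k : ℕ, k ≤ κ → ∫ t : ℝ, (t : ℂ) ^ k * a t * ((|t| ^ (2 * lam) : ℝ) : ℂ) = 0

/-- `a` is a `p_λ`-atom with size constant `A` and vanishing moments up to order `κ`. -/
def IsDunklAtom (lam p A : ℝ) (κ : ℕ) (a : ℝ → ℂ) : Prop :=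
  ∃ x₀ δ₀ : ℝ, IsDunklAtomOn lam p A κ x₀ δ₀ a

/-! The problem is invariant under dilation. The kernel is homogeneous of degree `-(2λ+1)`, up to a
sign for negative factors, so dilating by `x₀` puts the atom in a ball of centre `1` and radius `d =
δ₀/|x₀| < 1/2`, with `y` replaced by `y/|x₀|`. Multiplying by the weight `|t|^(2λ)` turns it into a
function `f` supported there, bounded by some `B` and with vanishing ordinary moments. It then
suffices to bound the weighted integral of the `p`-th power by a constant times `B^p d`, uniformly
in `y`; the lower bound for `|I(x₀, δ₀)|_λ` makes this quantity, scaled back, bounded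
(`atom_constant_bound`).

The substitution `u = (1 - sgn(xt) cos θ)/2` gives the kernel the same form for both signs of `xt`,
with the quadratic denominator `kernelDen`. With `r = ||x| - 1|`, three regions are treated.

Far region, `r ≥ 3d/2`: for each fixed `u` the integrand is approximated in `t` by a polynomial of
degree at most `2N`, `N = ⌊(2λ+1)(1-p)/p⌋`, which the moments annihilate. This yields `B (d/r)^(N+2)
(|x|+1)^(-2λ)` (`exists_norm_reducedIntegral_far_le`). After the `p`-th power and the weight, the
decay exponent in `r/d` is `γ = (N+2)p - 2λ(1-p)`, and the choice of `N` is exactly what makes `γ >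
1`.

Near `-1`: the kernel has an integrable singularity, so the operator is `O(B)` without cancellation
(`exists_norm_reducedIntegral_mirror_le`).

Near `1`: up to a bounded error the kernel is the classical conjugate Poisson kernel times a bounded
function of `t` alone (`exists_abs_reducedKernel_sub_le`). The classical operator is bounded in `L²`
uniformly in `y` (`integral_norm_sq_hilbert_le`), and `s^p ≤ 1 + s²` converts this to the `p`-th
power on an interval of length comparable to `d`. -/

/-! ### Reduction of the kernel to an integral over `(0, 1)`. -/

/-- The quadratic form in the denominator of the reduced kernel. -/
noncomputable def kernelDen (y x t u : ℝ) : ℝ :=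
  y ^ 2 + (1 - u) * (x - t) ^ 2 + u * (x + t) ^ 2

/-- The symmetric part of the conjugate Poisson kernel, written over `(0, 1)`. -/
noncomputable def reducedKernel (lam y x t : ℝ) : ℝ :=
  ∫ u in Set.Ioo (0 : ℝ) 1, u ^ (lam - 1) * (1 - u) ^ lam * kernelDen y x t u ^ (-(lam + 1))

/-- The constant relating the conjugate Poisson kernel to the reduced kernel. -/
noncomputable def reducedConst (lam : ℝ) : ℝ :=
  lam * Real.Gamma (lam + 1 / 2) / ((2 : ℝ) ^ (-lam - 1 / 2) * Real.pi) * 2 ^ (2 * lam)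

/-- Here `σ` stands for the sign of `xt`; carrying it inside the substitution lets one formula serve
both signs. -/
theorem image_half_one_sub_cos {σ : ℝ} (hσ : σ = 1 ∨ σ = -1) :
    (fun θ => (1 - σ * Real.cos θ) / 2) '' Set.Ioo 0 Real.pi = Set.Ioo 0 1 := by
  ext u
  simp only [Set.mem_image, Set.mem_Ioo]
  constructor
  · rintro ⟨θ, ⟨h0, h1⟩, rfl⟩
    have hs := Real.sin_pos_of_pos_of_lt_pi h0 h1
    have h2 := Real.sin_sq_add_cos_sq θ
    have h3 : Real.cos θ < 1 := by nlinarith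
    have h4 : -1 < Real.cos θ := by nlinarith
    rcases hσ with rfl | rfl <;> constructor <;> linarith
  · rintro ⟨h0, h1⟩
    have hσ2 : σ * σ = 1 := by rcases hσ with rfl | rfl <;> norm_num
    have hb : -1 < σ * (1 - 2 * u) ∧ σ * (1 - 2 * u) < 1 := by
      rcases hσ with rfl | rfl <;> constructor <;> linarith
    refine ⟨Real.arccos (σ * (1 - 2 * u)), ⟨Real.arccos_pos.2 hb.2, ?_⟩, ?_⟩
    · refine lt_of_le_of_ne (Real.arccos_le_pi _) fun h => ?_
      have := Real.arccos_eq_pi.1 h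
      linarith [hb.1]
    · rw [Real.cos_arccos hb.1.le hb.2.le, ← mul_assoc, hσ2]
      ring

theorem injOn_half_one_sub_cos {σ : ℝ} (hσ : σ = 1 ∨ σ = -1) :
    Set.InjOn (fun θ => (1 - σ * Real.cos θ) / 2) (Set.Ioo 0 Real.pi) := by
  intro a ha b hb hab
  have : Real.cos a = Real.cos b := by
    simp only at hab
    rcases hσ with rfl | rfl <;> linarith
  exact Real.injOn_cos ⟨ha.1.le, ha.2.le⟩ ⟨hb.1.le, hb.2.le⟩ this

theorem half_mul_sq_div_four_rpow {s : ℝ} (hs : 0 < s) (lam : ℝ) :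
    s / 2 * (s ^ 2 / 4) ^ (lam - 1) = s ^ (2 * lam - 1) * 2 * (2 ^ (2 * lam))⁻¹ := by
  have h1 : s ^ 2 / 4 = (s / 2) ^ (2 : ℝ) := by
    rw [Real.rpow_two]; ring
  rw [h1, ← Real.rpow_mul (by positivity)]
  have h2 : s / 2 * (s / 2) ^ (2 * (lam - 1)) = (s / 2) ^ (2 * lam - 1) := by
    rw [mul_comm, ← Real.rpow_add_one (by positivity)]
    congr 1; ring
  rw [h2, Real.div_rpow hs.le (by norm_num), Real.rpow_sub_one (by norm_num : (2 : ℝ) ≠ 0)]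
  have : (0 : ℝ) < 2 ^ (2 * lam) := by positivity
  field_simp

/-- With `u = (1 - σ cos θ)/2` one has `sin² θ = 4u(1 - u)` and `1 + σ cos θ = 2(1 - u)`, and the
denominator becomes a convex combination of `(x - t)²` and `(x + t)²`, plus `y²`. -/
theorem conjPoissonKernel_eq {lam y x t : ℝ} (hy : 0 < y) (hx : x ≠ 0) (ht : t ≠ 0) :
    conjPoissonKernel lam y x t = reducedConst lam * ((x - t) * reducedKernel lam y x t) := by
  obtain ⟨σ, hσ, hsign, habs⟩ : ∃ σ : ℝ, (σ = 1 ∨ σ = -1) ∧ Real.sign (x * t) = σ ∧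
      |x * t| = σ * (x * t) := by
    rcases lt_or_gt_of_ne (mul_ne_zero hx ht) with h | h
    · exact ⟨-1, Or.inr rfl, Real.sign_of_neg h, by rw [abs_of_neg h]; ring⟩
    · exact ⟨1, Or.inl rfl, Real.sign_of_pos h, by rw [abs_of_pos h]; ring⟩
  have hσ2 : σ ^ 2 = 1 := by rcases hσ with rfl | rfl <;> norm_num
  have key : (∫ θ in (0 : ℝ)..Real.pi,
      (x - t) * (1 + Real.sign (x * t) * Real.cos θ) /
          (y ^ 2 + x ^ 2 + t ^ 2 - 2 * |x * t| * Real.cos θ) ^ (lam + 1) *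
        Real.sin θ ^ (2 * lam - 1)) = 2 ^ (2 * lam) * ((x - t) * reducedKernel lam y x t) := by
    rw [intervalIntegral.integral_of_le Real.pi_pos.le, integral_Ioc_eq_integral_Ioo,
      reducedKernel, ← image_half_one_sub_cos hσ,
      integral_image_eq_integral_abs_deriv_smul (f' := fun θ => σ * Real.sin θ / 2)
        measurableSet_Ioo ?_ (injOn_half_one_sub_cos hσ), ← integral_const_mul,
        ← integral_const_mul]
    · refine setIntegral_congr_fun measurableSet_Ioo fun θ hθ => ?_
      have hs : 0 < Real.sin θ := Real.sin_pos_of_pos_of_lt_pi hθ.1 hθ.2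
      have hsc := Real.sin_sq_add_cos_sq θ
      have hu : (1 - σ * Real.cos θ) / 2 ∈ Set.Ioo (0 : ℝ) 1 := by
        rw [← image_half_one_sub_cos hσ]; exact ⟨θ, hθ, rfl⟩
      have hden : kernelDen y x t ((1 - σ * Real.cos θ) / 2) =
          y ^ 2 + x ^ 2 + t ^ 2 - 2 * |x * t| * Real.cos θ := by
        rw [habs, kernelDen]; ring
      have hdpos : 0 < kernelDen y x t ((1 - σ * Real.cos θ) / 2) := by
        have h1 := hu.1
        have h2 : 0 < 1 - (1 - σ * Real.cos θ) / 2 := by linarith [hu.2]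
        unfold kernelDen; positivity
      have h1u : 0 < 1 - (1 - σ * Real.cos θ) / 2 := by linarith [hu.2]
      have hjac : |σ * Real.sin θ / 2| = Real.sin θ / 2 := by
        rcases hσ with rfl | rfl
        · rw [one_mul, abs_of_pos (by linarith)]
        · rw [abs_of_neg (by linarith)]; ring
      have hprod : (1 - σ * Real.cos θ) / 2 * (1 - (1 - σ * Real.cos θ) / 2) =
          Real.sin θ ^ 2 / 4 := by
        linear_combination (-(Real.cos θ) ^ 2 / 4) * hσ2 - hsc / 4
      have hpow : ((1 - σ * Real.cos θ) / 2) ^ (lam - 1) *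
          (1 - (1 - σ * Real.cos θ) / 2) ^ lam =
          (Real.sin θ ^ 2 / 4) ^ (lam - 1) * ((1 + σ * Real.cos θ) / 2) := by
        rw [← hprod, Real.mul_rpow hu.1.le h1u.le, mul_assoc]
        congr 1
        have : (1 + σ * Real.cos θ) / 2 = 1 - (1 - σ * Real.cos θ) / 2 := by ring
        rw [this, ← Real.rpow_add_one h1u.ne']
        congr 1; ring
      simp only [smul_eq_mul]
      rw [hjac, hpow, hsign, Real.rpow_neg hdpos.le, hden]
      have h5 := half_mul_sq_div_four_rpow hs lam
      have h6 : (0 : ℝ) < 2 ^ (2 * lam) := by positivity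
      have h7 : Real.sin θ / 2 * ((Real.sin θ ^ 2 / 4) ^ (lam - 1) * ((1 + σ * Real.cos θ) / 2) *
          ((y ^ 2 + x ^ 2 + t ^ 2 - 2 * |x * t| * Real.cos θ) ^ (lam + 1))⁻¹) =
          (Real.sin θ / 2 * (Real.sin θ ^ 2 / 4) ^ (lam - 1)) * ((1 + σ * Real.cos θ) / 2) *
          ((y ^ 2 + x ^ 2 + t ^ 2 - 2 * |x * t| * Real.cos θ) ^ (lam + 1))⁻¹ := by ring
      rw [h7, h5, div_eq_mul_inv]
      field_simp
    · intro θ _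
      have h := (((Real.hasDerivAt_cos θ).const_mul σ).const_sub 1).div_const 2
      refine (h.congr_deriv ?_).hasDerivWithinAt
      ring
  rw [conjPoissonKernel, key, reducedConst]
  ring

/-! ### Beta-type integrals and size estimates for the reduced kernel. -/

theorem integrableOn_rpow_sub_one {a : ℝ} (ha : 0 < a) :
    IntegrableOn (fun u : ℝ => u ^ (a - 1)) (Set.Ioo 0 1) := by
  rw [← intervalIntegrable_iff_integrableOn_Ioo_of_le zero_le_one]
  exact intervalIntegral.intervalIntegrable_rpow' (by linarith)

theorem integrableOn_beta {a b : ℝ} (ha : 0 < a) (hb : 0 < b) :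
    IntegrableOn (fun u : ℝ => u ^ (a - 1) * (1 - u) ^ (b - 1)) (Set.Ioo 0 1) := by
  have h := Complex.betaIntegral_convergent (u := a) (v := b) (by simpa) (by simpa)
  rw [intervalIntegrable_iff_integrableOn_Ioo_of_le zero_le_one] at h
  refine IntegrableOn.congr_fun (f := fun u : ℝ => ‖(u : ℂ) ^ ((a : ℂ) - 1) * (1 - (u : ℂ)) ^ ((b : ℂ) - 1)‖)
    h.norm (fun u hu => ?_) measurableSet_Ioo
  have h1 : 0 < 1 - u := by linarith [hu.2]
  have h2 : (1 : ℂ) - u = ((1 - u : ℝ) : ℂ) := by push_cast; ring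
  simp only [norm_mul]
  rw [h2, Complex.norm_cpow_eq_rpow_re_of_pos hu.1, Complex.norm_cpow_eq_rpow_re_of_pos h1]
  simp

theorem kernelDen_pos {y x t u : ℝ} (hy : 0 < y) (hu : u ∈ Set.Ioo (0 : ℝ) 1) :
    0 < kernelDen y x t u := by
  have h1 := hu.1
  have h2 : 0 < 1 - u := by linarith [hu.2]
  unfold kernelDen; positivity

theorem kernelDen_eq_affine (y x t u : ℝ) :
    kernelDen y x t u = (1 - u) * (y ^ 2 + (x - t) ^ 2) + u * (y ^ 2 + (x + t) ^ 2) := by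
  unfold kernelDen; ring

theorem affine_pos {D E u : ℝ} (hD : 0 < D) (hE : 0 < E) (hu : u ∈ Set.Icc (0 : ℝ) 1) :
    0 < (1 - u) * D + u * E := by
  rcases hu.1.eq_or_lt with h | h
  · simpa [← h]
  · have : 0 ≤ 1 - u := by linarith [hu.2]
    positivity

theorem integrableOn_rpow_mul_affine {a D E : ℝ} (ha : 0 < a) (hD : 0 < D) (hE : 0 < E) (c : ℝ) :
    IntegrableOn (fun u : ℝ => u ^ (a - 1) * ((1 - u) * D + u * E) ^ c) (Set.Ioo 0 1) := by
  rw [← intervalIntegrable_iff_integrableOn_Ioo_of_le zero_le_one]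
  refine IntervalIntegrable.mul_continuousOn
    (intervalIntegral.intervalIntegrable_rpow' (by linarith)) ?_
  rw [Set.uIcc_of_le zero_le_one]
  refine ContinuousOn.rpow_const (by fun_prop) fun u hu => Or.inl (affine_pos hD hE hu).ne'

/-- `(u / ((1 - u) D + u E)) ^ lam` is a primitive. -/
theorem integral_rpow_mul_affine {lam D E : ℝ} (hlam : 0 < lam) (hD : 0 < D) (hE : 0 < E) :
    ∫ u in Set.Ioo (0 : ℝ) 1, u ^ (lam - 1) * ((1 - u) * D + u * E) ^ (-(lam + 1)) =
      1 / (lam * D * E ^ lam) := by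
  have hint := integrableOn_rpow_mul_affine hlam hD hE (-(lam + 1))
  rw [← intervalIntegrable_iff_integrableOn_Ioo_of_le zero_le_one] at hint
  rw [← integral_Ioc_eq_integral_Ioo, ← intervalIntegral.integral_of_le zero_le_one]
  have := intervalIntegral.integral_eq_sub_of_hasDerivAt_of_le zero_le_one
    (f := fun u => (u / ((1 - u) * D + u * E)) ^ lam / (lam * D)) ?_ ?_ hint
  · rw [this]
    have h0 : (0 / ((1 - 0) * D + 0 * E)) ^ lam = 0 := by
      rw [zero_div, Real.zero_rpow hlam.ne']
    rw [h0]
    simp only [sub_self, zero_mul, zero_add, one_mul]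
    rw [Real.div_rpow zero_le_one hE.le, Real.one_rpow]
    have : 0 < E ^ lam := by positivity
    field_simp
    ring
  · refine ContinuousOn.div_const ?_ _
    refine ContinuousOn.rpow_const ?_ fun u _ => Or.inr hlam.le
    exact ContinuousOn.div (by fun_prop) (by fun_prop) fun u hu => (affine_pos hD hE hu).ne'
  · intro u hu
    have hp := affine_pos hD hE ⟨hu.1.le, hu.2.le⟩
    have hg : HasDerivAt (fun u => (1 - u) * D + u * E) (E - D) u := by
      have := (((hasDerivAt_id u).const_sub 1).mul_const D).add ((hasDerivAt_id u).mul_const E)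
      exact this.congr_deriv (by ring)
    have h1 := ((((hasDerivAt_id u).div hg hp.ne').rpow_const (p := lam)
      (Or.inl (div_pos hu.1 hp).ne')).div_const (lam * D))
    refine h1.congr_deriv ?_
    simp only [id, Pi.div_apply]
    rw [Real.div_rpow hu.1.le hp.le, Real.rpow_neg hp.le, Real.rpow_add_one hp.ne',
      Real.rpow_sub_one hp.ne']
    have hu0 := hu.1
    have : 0 < ((1 - u) * D + u * E) ^ lam := by positivity
    field_simp
    ring

theorem reducedKernel_nonneg {lam y x t : ℝ} (hy : 0 < y) : 0 ≤ reducedKernel lam y x t := by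
  refine setIntegral_nonneg measurableSet_Ioo fun u hu => ?_
  have h1 := hu.1
  have h2 : 0 < 1 - u := by linarith [hu.2]
  have := kernelDen_pos (x := x) (t := t) hy hu
  positivity

/-- If the weight is dominated pointwise on `(0, 1)`, so is the reduced kernel. -/
theorem reducedKernel_le {lam y x t : ℝ} (hy : 0 < y) {g : ℝ → ℝ}
    (hg : IntegrableOn g (Set.Ioo 0 1))
    (h : ∀ u ∈ Set.Ioo (0 : ℝ) 1,
      u ^ (lam - 1) * (1 - u) ^ lam * kernelDen y x t u ^ (-(lam + 1)) ≤ g u) :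
    reducedKernel lam y x t ≤ ∫ u in Set.Ioo (0 : ℝ) 1, g u := by
  refine integral_mono_of_nonneg ?_ hg ?_
  · filter_upwards [ae_restrict_mem measurableSet_Ioo] with u hu
    have h1 := hu.1
    have h2 : 0 < 1 - u := by linarith [hu.2]
    have := kernelDen_pos (x := x) (t := t) hy hu
    simp only [Pi.zero_apply]
    positivity
  · filter_upwards [ae_restrict_mem measurableSet_Ioo] with u hu using h u hu

/-- Bounding `(1 - u)^λ` by `1` leaves an integral with a closed form. -/
theorem reducedKernel_le_of_ne {lam y x t : ℝ} (hlam : 0 < lam) (hy : 0 < y) :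
    reducedKernel lam y x t ≤
      1 / (lam * (y ^ 2 + (x - t) ^ 2) * (y ^ 2 + (x + t) ^ 2) ^ lam) := by
  rw [← integral_rpow_mul_affine hlam (by positivity) (by positivity)]
  refine reducedKernel_le hy (integrableOn_rpow_mul_affine hlam (by positivity) (by positivity) _)
    fun u hu => ?_
  rw [← kernelDen_eq_affine]
  have h1 := hu.1
  have h2 : 0 < 1 - u := by linarith [hu.2]
  have := kernelDen_pos (x := x) (t := t) hy hu
  have h3 : (1 - u) ^ lam ≤ 1 := Real.rpow_le_one h2.le (by linarith) hlam.le
  have h4 : 0 < u ^ (lam - 1) := by positivity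
  have h5 : 0 < kernelDen y x t u ^ (-(lam + 1)) := by positivity
  calc _ ≤ u ^ (lam - 1) * 1 * kernelDen y x t u ^ (-(lam + 1)) := by gcongr
    _ = _ := by ring

/-- Size estimate for arguments of opposite sign. -/
theorem reducedKernel_le_of_neg {lam y x t e : ℝ} (hlam : 0 < lam) (hy : 0 < y) (he : 0 < e)
    (he1 : e ≤ 1) (hx : x < 0) (ht : 0 < t) (hxt : x + t ≠ 0) :
    reducedKernel lam y x t ≤ (∫ u in Set.Ioo (0 : ℝ) 1, u ^ (lam - 1) * (1 - u) ^ (e - 1)) *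
      (((t - x) ^ 2) ^ (-(lam + 1 - e)) * ((x + t) ^ 2) ^ (-e)) := by
  rw [← integral_mul_const]
  refine reducedKernel_le hy ((integrableOn_beta hlam he).mul_const _) fun u hu => ?_
  have h1 := hu.1
  have h2 : 0 < 1 - u := by linarith [hu.2]
  have hG := kernelDen_pos (x := x) (t := t) hy hu
  have hr : 0 < (x + t) ^ 2 := by positivity
  have hR : 0 < (t - x) ^ 2 := by have : 0 < t - x := by linarith
                                  positivity
  have hG1 : (1 - u) * (t - x) ^ 2 ≤ kernelDen y x t u := by
    unfold kernelDen
    nlinarith [mul_pos h1 hr, sq_nonneg y]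
  have hG2 : (x + t) ^ 2 ≤ kernelDen y x t u := by
    unfold kernelDen
    nlinarith [sq_nonneg y, mul_pos h2 (mul_pos ht (neg_pos.2 hx))]
  -- The power `λ + 1` is shared between two lower bounds for the denominator: `e` goes to `(x +
  -- t)²`, the rest to `(1 - u)(t - x)²`, so that the factor `(1 - u)^(e - 1)` stays integrable.
  have hsplit : kernelDen y x t u ^ (-(lam + 1)) ≤
      ((1 - u) * (t - x) ^ 2) ^ (-(lam + 1 - e)) * ((x + t) ^ 2) ^ (-e) := by
    have : kernelDen y x t u ^ (-(lam + 1)) =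
        kernelDen y x t u ^ (-(lam + 1 - e)) * kernelDen y x t u ^ (-e) := by
      rw [← Real.rpow_add hG]; congr 1; ring
    rw [this]
    have ha := Real.rpow_le_rpow_of_nonpos (by positivity) hG1 (by linarith : -(lam + 1 - e) ≤ 0)
    have hb := Real.rpow_le_rpow_of_nonpos hr hG2 (by linarith : -e ≤ 0)
    gcongr
  calc _ ≤ u ^ (lam - 1) * (1 - u) ^ lam *
        (((1 - u) * (t - x) ^ 2) ^ (-(lam + 1 - e)) * ((x + t) ^ 2) ^ (-e)) := by gcongr
    _ = _ := by
      rw [Real.mul_rpow h2.le hR.le]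
      have : (1 - u) ^ (e - 1) = (1 - u) ^ lam * (1 - u) ^ (-(lam + 1 - e)) := by
        rw [← Real.rpow_add h2]; congr 1; ring
      rw [this]; ring

/-! ### Comparison with the classical conjugate Poisson kernel near the diagonal. -/

theorem abs_one_sub_one_sub_rpow_le {lam u : ℝ} (hlam : 0 < lam) (hu : u ∈ Set.Ioo (0 : ℝ) 1) :
    |1 - (1 - u) ^ lam| ≤ max 1 lam * u := by
  have h2 : 0 < 1 - u := by linarith [hu.2]
  have h3 : (1 - u) ^ lam ≤ 1 := Real.rpow_le_one h2.le (by linarith [hu.1]) hlam.le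
  rw [abs_of_nonneg (by linarith)]
  have h4 := mul_le_mul_of_nonneg_right (le_max_left 1 lam) hu.1.le
  have h5 := mul_le_mul_of_nonneg_right (le_max_right 1 lam) hu.1.le
  rcases le_total lam 1 with h | h
  · have : (1 - u) ^ (1 : ℝ) ≤ (1 - u) ^ lam :=
      Real.rpow_le_rpow_of_exponent_ge h2 (by linarith [hu.1]) h
    rw [Real.rpow_one] at this
    linarith
  · have := one_add_mul_self_le_rpow_one_add (s := -u) (by linarith [hu.2]) h
    have h6 : 1 + -u = 1 - u := by ring
    rw [h6] at this
    linarith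

/-- Mean value inequality. The derivative is bounded uniformly in `y` because its factor `z` is
absorbed by `(y² + z²)^(-1/2)`. -/
theorem abs_rpow_neg_sub_rpow_neg_le {lam y v w : ℝ} (hlam : 0 < lam) (hv : 1 / 2 ≤ v)
    (hw : 1 / 2 ≤ w) :
    |(y ^ 2 + v ^ 2) ^ (-lam) - (y ^ 2 + w ^ 2) ^ (-lam)| ≤
      2 * lam * (1 / 4) ^ (-(lam + 1 / 2)) * |v - w| := by
  have hpos : ∀ z ∈ Set.Ici (1 / 2 : ℝ), 0 < y ^ 2 + z ^ 2 := fun z hz => by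
    have : (0 : ℝ) < z := by linarith [Set.mem_Ici.1 hz]
    positivity
  have h := (convex_Ici (1 / 2 : ℝ)).norm_image_sub_le_of_norm_hasDerivWithin_le
    (f := fun z => (y ^ 2 + z ^ 2) ^ (-lam))
    (f' := fun z => 2 * z * (-lam) * (y ^ 2 + z ^ 2) ^ (-lam - 1))
    (C := 2 * lam * (1 / 4) ^ (-(lam + 1 / 2))) (fun z hz => ?_) (fun z hz => ?_) hw hv
  · simpa [Real.norm_eq_abs] using h
  · have h1 : HasDerivAt (fun z : ℝ => y ^ 2 + z ^ 2) (2 * z) z := by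
      simpa using (hasDerivAt_pow 2 z).const_add (y ^ 2)
    exact (h1.rpow_const (Or.inl (hpos z hz).ne')).hasDerivWithinAt
  · have hz0 : (0 : ℝ) < z := by linarith [Set.mem_Ici.1 hz]
    have hp := hpos z hz
    have e1 : (y ^ 2 + z ^ 2) ^ (-lam - 1) =
        (y ^ 2 + z ^ 2) ^ (-(lam + 1 / 2)) * (y ^ 2 + z ^ 2) ^ (-(1 / 2) : ℝ) := by
      rw [← Real.rpow_add hp]; congr 1; ring
    have e2 : (y ^ 2 + z ^ 2) ^ (-(1 / 2) : ℝ) ≤ z⁻¹ := by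
      rw [Real.rpow_neg hp.le, ← Real.sqrt_eq_rpow]
      gcongr
      exact Real.le_sqrt_of_sq_le (by nlinarith [sq_nonneg y])
    have e3 : (y ^ 2 + z ^ 2) ^ (-(lam + 1 / 2)) ≤ (1 / 4) ^ (-(lam + 1 / 2)) := by
      refine Real.rpow_le_rpow_of_nonpos (by norm_num) ?_ (by linarith)
      nlinarith [sq_nonneg y, Set.mem_Ici.1 hz]
    rw [Real.norm_eq_abs, abs_mul, abs_of_pos (Real.rpow_pos_of_pos hp _), e1]
    have e4 : |2 * z * -lam| = 2 * lam * z := by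
      rw [abs_of_neg (by nlinarith)]; ring
    rw [e4]
    calc _ ≤ 2 * lam * z * ((1 / 4) ^ (-(lam + 1 / 2)) * z⁻¹) := by gcongr
      _ = _ := by field_simp

/-- Half a power of `G` absorbs `|x - t|`; the remaining `λ + 1/2` powers cost `u^(-(λ + 1/2))`.
Since `1 - (1 - u)^λ = O(u)`, what is left is the integrable `u^(-1/2)`. -/
theorem abs_mul_error_integrand_le {lam x t u G : ℝ} (hlam : 0 < lam)
    (hu : u ∈ Set.Ioo (0 : ℝ) 1) (hG : 0 < G) (hG1 : (x - t) ^ 2 ≤ G) (hG2 : u * (1 / 4) ≤ G) :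
    ‖(x - t) * (u ^ (lam - 1) * (1 - u) ^ lam * G ^ (-(lam + 1)) -
      u ^ (lam - 1) * G ^ (-(lam + 1)))‖ ≤
      (max 1 lam * (1 / 4) ^ (-(lam + 1 / 2))) * u ^ ((1 / 2 : ℝ) - 1) := by
  have h1 := hu.1
  have hGs : G ^ (-(lam + 1)) = G ^ (-(lam + 1 / 2)) * G ^ (-(1 / 2) : ℝ) := by
    rw [← Real.rpow_add hG]; congr 1; ring
  have hGh : |x - t| * G ^ (-(1 / 2) : ℝ) ≤ 1 := by
    rw [Real.rpow_neg hG.le, ← Real.sqrt_eq_rpow, ← div_eq_mul_inv,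
      div_le_one (Real.sqrt_pos.2 hG)]
    exact Real.le_sqrt_of_sq_le (by rwa [sq_abs])
  have hGl : G ^ (-(lam + 1 / 2)) ≤ u ^ (-(lam + 1 / 2)) * (1 / 4) ^ (-(lam + 1 / 2)) := by
    rw [← Real.mul_rpow h1.le (by norm_num)]
    exact Real.rpow_le_rpow_of_nonpos (by positivity) hG2 (by linarith)
  have hrw : (x - t) * (u ^ (lam - 1) * (1 - u) ^ lam * G ^ (-(lam + 1)) -
      u ^ (lam - 1) * G ^ (-(lam + 1))) =
      -((x - t) * u ^ (lam - 1) * (1 - (1 - u) ^ lam) * G ^ (-(lam + 1))) := by ring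
  have hul : u ^ ((1 / 2 : ℝ) - 1) = u ^ (lam - 1) * u * u ^ (-(lam + 1 / 2)) := by
    rw [← Real.rpow_add_one h1.ne', ← Real.rpow_add h1]; congr 1; ring
  rw [hrw, norm_neg, Real.norm_eq_abs, abs_mul, abs_mul, abs_mul,
    abs_of_pos (Real.rpow_pos_of_pos h1 _), abs_of_pos (Real.rpow_pos_of_pos hG _), hGs, hul]
  have hb := abs_one_sub_one_sub_rpow_le hlam hu
  calc _ = u ^ (lam - 1) * |1 - (1 - u) ^ lam| * G ^ (-(lam + 1 / 2)) *
        (|x - t| * G ^ (-(1 / 2) : ℝ)) := by ring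
    _ ≤ u ^ (lam - 1) * (max 1 lam * u) * (u ^ (-(lam + 1 / 2)) *
        (1 / 4) ^ (-(lam + 1 / 2))) * 1 := by gcongr
    _ = _ := by ring

/-- Replacing `(1 - u)^λ` by `1` gives the closed form exactly, and costs only a bounded error even
on the diagonal. -/
theorem abs_reducedKernel_sub_main_le {lam y x t : ℝ} (hlam : 0 < lam) (hy : 0 < y)
    (hx : 1 / 4 < x) (ht : 1 / 2 < t) :
    |x - t| * |reducedKernel lam y x t -
      1 / (lam * (y ^ 2 + (x - t) ^ 2) * (y ^ 2 + (x + t) ^ 2) ^ lam)| ≤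
      (max 1 lam * (1 / 4) ^ (-(lam + 1 / 2))) * (∫ u in Set.Ioo (0 : ℝ) 1,
        u ^ ((1 / 2 : ℝ) - 1)) := by
  have hD : 0 < y ^ 2 + (x - t) ^ 2 := by positivity
  have hE : 0 < y ^ 2 + (x + t) ^ 2 := by positivity
  have hmain := integral_rpow_mul_affine hlam hD hE
  have hI1 := integrableOn_rpow_mul_affine hlam hD hE (-(lam + 1))
  have hI2 : IntegrableOn (fun u : ℝ => u ^ (lam - 1) * (1 - u) ^ lam *
      ((1 - u) * (y ^ 2 + (x - t) ^ 2) + u * (y ^ 2 + (x + t) ^ 2)) ^ (-(lam + 1)))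
      (Set.Ioo 0 1) := by
    refine Integrable.mono' hI1 (Measurable.aestronglyMeasurable (by fun_prop)) ?_
    filter_upwards [ae_restrict_mem measurableSet_Ioo] with u hu
    have h1 := hu.1
    have h2 : 0 < 1 - u := by linarith [hu.2]
    have := affine_pos hD hE ⟨hu.1.le, hu.2.le⟩
    have h3 : (1 - u) ^ lam ≤ 1 := Real.rpow_le_one h2.le (by linarith) hlam.le
    rw [Real.norm_eq_abs, abs_of_pos (by positivity)]
    calc _ ≤ u ^ (lam - 1) * 1 * _ := by gcongr
      _ = _ := by rw [mul_one]
  have e0 : reducedKernel lam y x t = ∫ u in Set.Ioo (0 : ℝ) 1, u ^ (lam - 1) * (1 - u) ^ lam *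
      ((1 - u) * (y ^ 2 + (x - t) ^ 2) + u * (y ^ 2 + (x + t) ^ 2)) ^ (-(lam + 1)) := by
    simp only [reducedKernel, kernelDen_eq_affine]
  rw [← hmain, e0, ← integral_sub hI2 hI1, ← abs_mul, ← integral_const_mul, ← integral_const_mul,
    ← Real.norm_eq_abs]
  refine norm_integral_le_of_norm_le
    ((integrableOn_rpow_sub_one (by norm_num : (0 : ℝ) < 1 / 2)).const_mul _) ?_
  filter_upwards [ae_restrict_mem measurableSet_Ioo] with u hu
  have h1 := hu.1
  have h2 : 0 < 1 - u := by linarith [hu.2]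
  refine abs_mul_error_integrand_le hlam hu (affine_pos hD hE ⟨hu.1.le, hu.2.le⟩) ?_ ?_
  · nlinarith [sq_nonneg y, mul_pos h1 (mul_pos (by linarith : 0 < x) (by linarith : 0 < t))]
  · have : 1 / 4 ≤ (x + t) ^ 2 := by nlinarith
    nlinarith [sq_nonneg y, mul_le_mul_of_nonneg_left this h1.le,
      mul_nonneg h2.le (sq_nonneg (x - t))]

/-- Comparison of the kernel with the classical conjugate Poisson kernel near `(1, 1)`. -/
theorem exists_abs_reducedKernel_sub_le {lam : ℝ} (hlam : 0 < lam) :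
    ∃ C : ℝ, 0 < C ∧ ∀ y x t : ℝ, 0 < y → 1 / 4 < x → 1 / 2 < t →
      |(x - t) * reducedKernel lam y x t -
        (x - t) / (y ^ 2 + (x - t) ^ 2) * ((y ^ 2 + (2 * t) ^ 2) ^ (-lam) / lam)| ≤ C := by
  refine ⟨(max 1 lam * (1 / 4) ^ (-(lam + 1 / 2))) * (∫ u in Set.Ioo (0 : ℝ) 1,
    u ^ ((1 / 2 : ℝ) - 1)) + 2 * (1 / 4) ^ (-(lam + 1 / 2)), ?_, fun y x t hy hx ht => ?_⟩
  · have : 0 ≤ ∫ u in Set.Ioo (0 : ℝ) 1, u ^ ((1 / 2 : ℝ) - 1) :=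
      setIntegral_nonneg measurableSet_Ioo fun u hu => Real.rpow_nonneg hu.1.le _
    positivity
  have hD : 0 < y ^ 2 + (x - t) ^ 2 := by positivity
  have hE : 0 < y ^ 2 + (x + t) ^ 2 := by positivity
  have herr := abs_reducedKernel_sub_main_le hlam hy hx ht
  have hcmp := abs_rpow_neg_sub_rpow_neg_le (lam := lam) (y := y) (v := x + t) (w := 2 * t) hlam
    (by linarith) (by linarith)
  have hxt : x + t - 2 * t = x - t := by ring
  rw [hxt] at hcmp
  -- Freezing `x + t` at `2t` makes the extra factor depend on `t` alone, so it can be moved into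
  -- the function. The Lipschitz bound supplies a second `|x - t|`, which cancels the singularity.
  have hsecond : |(x - t) / (y ^ 2 + (x - t) ^ 2) / lam * ((y ^ 2 + (x + t) ^ 2) ^ (-lam) -
      (y ^ 2 + (2 * t) ^ 2) ^ (-lam))| ≤ 2 * (1 / 4) ^ (-(lam + 1 / 2)) := by
    rw [abs_mul, abs_div, abs_div, abs_of_pos hD, abs_of_pos hlam]
    calc _ ≤ |x - t| / (y ^ 2 + (x - t) ^ 2) / lam *
          (2 * lam * (1 / 4) ^ (-(lam + 1 / 2)) * |x - t|) := by gcongr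
      _ = 2 * (1 / 4) ^ (-(lam + 1 / 2)) * ((x - t) ^ 2 / (y ^ 2 + (x - t) ^ 2)) := by
        rw [← sq_abs (x - t)]; field_simp
      _ ≤ 2 * (1 / 4) ^ (-(lam + 1 / 2)) * 1 := by
        gcongr
        rw [div_le_one hD]; nlinarith [sq_nonneg y]
      _ = _ := mul_one _
  have hdec : (x - t) * reducedKernel lam y x t -
        (x - t) / (y ^ 2 + (x - t) ^ 2) * ((y ^ 2 + (2 * t) ^ 2) ^ (-lam) / lam) =
      (x - t) * (reducedKernel lam y x t -
        1 / (lam * (y ^ 2 + (x - t) ^ 2) * (y ^ 2 + (x + t) ^ 2) ^ lam)) +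
      (x - t) / (y ^ 2 + (x - t) ^ 2) / lam * ((y ^ 2 + (x + t) ^ 2) ^ (-lam) -
      (y ^ 2 + (2 * t) ^ 2) ^ (-lam)) := by
    rw [Real.rpow_neg hE.le]
    have : 0 < (y ^ 2 + (x + t) ^ 2) ^ lam := by positivity
    field_simp
    ring
  rw [hdec]
  refine (abs_add_le _ _).trans (add_le_add ?_ hsecond)
  rw [abs_mul]
  exact herr

/-! ### Size of the kernel away from the diagonal and near the reflected point. -/

/-- Size of the kernel with one argument at `1`. -/
theorem exists_reducedKernel_one_le {lam : ℝ} (hlam : 0 < lam) :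
    ∃ C : ℝ, 0 < C ∧ ∀ y x : ℝ, 0 < y → x ≠ 0 → |x| ≠ 1 →
      |x - 1| * reducedKernel lam y x 1 ≤ C * ((|x| + 1) ^ (-(2 * lam)) * (|(|x| - 1)|)⁻¹) := by
  refine ⟨1 / lam + ∫ u in Set.Ioo (0 : ℝ) 1, u ^ (lam - 1) * (1 - u) ^ ((1 / 2 : ℝ) - 1), ?_,
    fun y x hy hx hx1 => ?_⟩
  · have : 0 ≤ ∫ u in Set.Ioo (0 : ℝ) 1, u ^ (lam - 1) * (1 - u) ^ ((1 / 2 : ℝ) - 1) :=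
      setIntegral_nonneg measurableSet_Ioo fun u hu => mul_nonneg (Real.rpow_nonneg hu.1.le _)
        (Real.rpow_nonneg (by linarith [hu.2]) _)
    positivity
  have hI : 0 ≤ ∫ u in Set.Ioo (0 : ℝ) 1, u ^ (lam - 1) * (1 - u) ^ ((1 / 2 : ℝ) - 1) :=
      setIntegral_nonneg measurableSet_Ioo fun u hu => mul_nonneg (Real.rpow_nonneg hu.1.le _)
        (Real.rpow_nonneg (by linarith [hu.2]) _)
  have hr : 0 < |(|x| - 1)| := abs_pos.2 (sub_ne_zero.2 hx1)
  have hR : 0 < |x| + 1 := by positivity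
  have hM : 0 < (|x| + 1) ^ (-(2 * lam)) * (|(|x| - 1)|)⁻¹ := by positivity
  have hR2 : ∀ s : ℝ, ((|x| + 1) ^ 2) ^ s = (|x| + 1) ^ (2 * s) := fun s => by
    rw [← Real.rpow_two, ← Real.rpow_mul hR.le]
  rcases lt_or_gt_of_ne hx with h | h
  · have hax : |x| = -x := abs_of_neg h
    have hne : x + 1 ≠ 0 := fun h' => hx1 (by rw [hax]; linarith)
    -- The choice `e = 1/2` produces exactly one inverse power of `||x| - 1|`, matching the case `x
    -- > 0`.
    have hk := reducedKernel_le_of_neg (y := y) hlam hy (by norm_num : (0 : ℝ) < 1 / 2)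
      (by norm_num) h one_pos hne
    have e1 : (1 - x) ^ 2 = (|x| + 1) ^ 2 := by rw [hax]; ring
    have e2 : (x + 1) ^ 2 = |(|x| - 1)| ^ 2 := by rw [sq_abs, hax]; ring
    have e3 : |x - 1| = |x| + 1 := by rw [abs_of_neg (by linarith), hax]; ring
    have e4 : (|(|x| - 1)| ^ 2) ^ (-(1 / 2) : ℝ) = (|(|x| - 1)|)⁻¹ := by
      rw [← Real.rpow_two, ← Real.rpow_mul hr.le, ← Real.rpow_neg_one]; norm_num
    have e5 : (|x| + 1) ^ (2 * -(lam + 1 - 1 / 2)) * (|x| + 1) = (|x| + 1) ^ (-(2 * lam)) := by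
      rw [← Real.rpow_add_one hR.ne']; congr 1; ring
    rw [e1, e2, e4, hR2] at hk
    rw [e3]
    calc (|x| + 1) * reducedKernel lam y x 1 ≤ (|x| + 1) * _ := mul_le_mul_of_nonneg_left hk hR.le
      _ = (∫ u in Set.Ioo (0 : ℝ) 1, u ^ (lam - 1) * (1 - u) ^ ((1 / 2 : ℝ) - 1)) *
          (((|x| + 1) ^ (2 * -(lam + 1 - 1 / 2)) * (|x| + 1)) * (|(|x| - 1)|)⁻¹) := by ring
      _ ≤ _ := by
        rw [e5]
        refine mul_le_mul_of_nonneg_right ?_ hM.le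
        linarith [one_div_pos.2 hlam]
  · have hax : |x| = x := abs_of_pos h
    have hk := reducedKernel_le_of_ne (y := y) (x := x) (t := 1) hlam hy
    rw [hax] at hr hR hM hR2 ⊢
    have h1 : 1 / (lam * (y ^ 2 + (x - 1) ^ 2) * (y ^ 2 + (x + 1) ^ 2) ^ lam) ≤
        1 / (lam * (|x - 1| ^ 2) * ((x + 1) ^ 2) ^ lam) := by
      have : 0 < |x - 1| := hr
      rw [sq_abs]
      have : 0 < (x - 1) ^ 2 := by rw [← sq_abs]; positivity
      gcongr <;> nlinarith [sq_nonneg y]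
    calc |x - 1| * reducedKernel lam y x 1 ≤
          |x - 1| * (1 / (lam * (|x - 1| ^ 2) * ((x + 1) ^ 2) ^ lam)) := by
          gcongr; exact hk.trans h1
      _ = 1 / lam * ((x + 1) ^ (-(2 * lam)) * (|x - 1|)⁻¹) := by
        rw [hR2, Real.rpow_neg hR.le]
        have : 0 < (x + 1) ^ (2 * lam) := by positivity
        field_simp
      _ ≤ _ := by
        refine mul_le_mul_of_nonneg_right ?_ hM.le
        linarith

/-- Size of the kernel near `(-1, 1)`. -/
theorem exists_reducedKernel_neg_le {lam : ℝ} (hlam : 0 < lam) :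
    ∃ C : ℝ, 0 < C ∧ ∀ y x t : ℝ, 0 < y → x < 0 → 1 / 2 < t → x + t ≠ 0 →
      |x - t| * reducedKernel lam y x t ≤ C * |x + t| ^ (-(1 / 2) : ℝ) := by
  have hI : 0 ≤ ∫ u in Set.Ioo (0 : ℝ) 1, u ^ (lam - 1) * (1 - u) ^ ((1 / 4 : ℝ) - 1) :=
      setIntegral_nonneg measurableSet_Ioo fun u hu => mul_nonneg (Real.rpow_nonneg hu.1.le _)
        (Real.rpow_nonneg (by linarith [hu.2]) _)
  refine ⟨((∫ u in Set.Ioo (0 : ℝ) 1, u ^ (lam - 1) * (1 - u) ^ ((1 / 4 : ℝ) - 1)) + 1) *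
    (1 / 2) ^ (-(2 * lam + 1 / 2)), by positivity, fun y x t hy hx ht hne => ?_⟩
  -- The choice `e = 1/4` gives `|x + t|^(-1/2)`, which is locally integrable; `e = 1/2` would not
  -- be enough.
  have hk := reducedKernel_le_of_neg (y := y) hlam hy (by norm_num : (0 : ℝ) < 1 / 4)
      (by norm_num) hx (by linarith : 0 < t) hne
  have hR : 0 < t - x := by linarith
  have hr : 0 < |x + t| := abs_pos.2 hne
  have e1 : |x - t| = t - x := by rw [abs_of_neg (by linarith)]; ring
  have e2 : ((x + t) ^ 2) ^ (-(1 / 4) : ℝ) = |x + t| ^ (-(1 / 2) : ℝ) := by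
    rw [← sq_abs, ← Real.rpow_two, ← Real.rpow_mul hr.le]; norm_num
  have e3 : (t - x) * ((t - x) ^ 2) ^ (-(lam + 1 - 1 / 4)) = (t - x) ^ (-(2 * lam + 1 / 2)) := by
    rw [← Real.rpow_two, ← Real.rpow_mul hR.le, mul_comm, ← Real.rpow_add_one hR.ne']
    congr 1; ring
  have e4 : (t - x) ^ (-(2 * lam + 1 / 2)) ≤ (1 / 2) ^ (-(2 * lam + 1 / 2)) :=
    Real.rpow_le_rpow_of_nonpos (by norm_num) (by linarith) (by linarith)
  rw [e1]
  calc (t - x) * reducedKernel lam y x t ≤ (t - x) * _ := mul_le_mul_of_nonneg_left hk hR.le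
    _ = (∫ u in Set.Ioo (0 : ℝ) 1, u ^ (lam - 1) * (1 - u) ^ ((1 / 4 : ℝ) - 1)) *
        ((t - x) * ((t - x) ^ 2) ^ (-(lam + 1 - 1 / 4))) * |x + t| ^ (-(1 / 2) : ℝ) := by
        rw [e2]; ring
    _ ≤ _ := by
      rw [e3]
      gcongr
      linarith

/-! ### Uniform `L²` bound for the classical conjugate Poisson integral. -/

/-- The classical conjugate Poisson kernel, without its normalizing constant. -/
noncomputable def hilbertKernel (y s : ℝ) : ℝ := s / (y ^ 2 + s ^ 2)

theorem continuous_hilbertKernel {y : ℝ} (hy : 0 < y) : Continuous (hilbertKernel y) :=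
  continuous_id.div (by fun_prop) fun s => by positivity

theorem integrable_inv_sq_add_sq {y : ℝ} (hy : 0 < y) :
    Integrable fun s : ℝ => (y ^ 2 + s ^ 2)⁻¹ := by
  have h := (integrable_inv_one_add_sq.comp_div hy.ne').const_mul ((y ^ 2)⁻¹)
  refine h.congr (Filter.Eventually.of_forall fun s => ?_)
  simp only
  field_simp

theorem integral_univ_inv_sq_add_sq {y : ℝ} (hy : 0 < y) :
    ∫ s : ℝ, (y ^ 2 + s ^ 2)⁻¹ = Real.pi / y := by
  have h := Measure.integral_comp_div (fun s : ℝ => (1 + s ^ 2)⁻¹) y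
  rw [integral_univ_inv_one_add_sq] at h
  have h2 : (fun s : ℝ => (y ^ 2 + s ^ 2)⁻¹) = fun s => (y ^ 2)⁻¹ * (1 + (s / y) ^ 2)⁻¹ := by
    ext s; field_simp
  rw [h2, integral_const_mul, h, abs_of_pos hy, smul_eq_mul]
  field_simp

theorem sq_hilbertKernel_le {y : ℝ} (hy : 0 < y) (s : ℝ) :
    hilbertKernel y s ^ 2 ≤ (y ^ 2 + s ^ 2)⁻¹ := by
  have : 0 < y ^ 2 + s ^ 2 := by positivity
  rw [hilbertKernel, div_pow, div_le_iff₀ (by positivity), sq (y ^ 2 + s ^ 2), ← mul_assoc,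
    inv_mul_cancel₀ this.ne', one_mul]
  nlinarith [sq_nonneg y]

theorem abs_hilbertKernel_mul_le {y : ℝ} (hy : 0 < y) (s t : ℝ) :
    |hilbertKernel y s * hilbertKernel y t| ≤
      (1 / 2) * ((y ^ 2 + s ^ 2)⁻¹ + (y ^ 2 + t ^ 2)⁻¹) := by
  have h1 := sq_hilbertKernel_le hy s
  have h2 := sq_hilbertKernel_le hy t
  rw [abs_le]
  constructor <;>
    nlinarith [sq_nonneg (hilbertKernel y s - hilbertKernel y t),
      sq_nonneg (hilbertKernel y s + hilbertKernel y t)]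

theorem integrable_hilbertKernel_mul {y : ℝ} (hy : 0 < y) (a b : ℝ) :
    Integrable fun x => hilbertKernel y (x - a) * hilbertKernel y (x - b) := by
  have hg := integrable_inv_sq_add_sq hy
  have hc := continuous_hilbertKernel hy
  refine Integrable.mono' (((hg.comp_sub_right a).add (hg.comp_sub_right b)).const_mul (1 / 2))
    (Continuous.aestronglyMeasurable (by fun_prop)) ?_
  exact Filter.Eventually.of_forall fun x => abs_hilbertKernel_mul_le hy _ _

theorem tendsto_hilbertKernel {y : ℝ} (hy : 0 < y) {l : Filter ℝ}
    (hl : Filter.Tendsto (fun x : ℝ => |x|) l Filter.atTop) :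
    Filter.Tendsto (hilbertKernel y) l (nhds 0) ∧
      Filter.Tendsto (fun s => (y ^ 2 + s ^ 2)⁻¹) l (nhds 0) := by
  have h0 : Filter.Tendsto (fun s => (y ^ 2 + s ^ 2)⁻¹) l (nhds 0) := by
    refine Filter.Tendsto.inv_tendsto_atTop (Filter.tendsto_atTop_add_const_left _ _ ?_)
    have := (Filter.tendsto_pow_atTop (α := ℝ) two_ne_zero).comp hl
    refine this.congr fun s => ?_
    simp
  refine ⟨?_, h0⟩
  have h1 : Filter.Tendsto (fun s => Real.sqrt ((y ^ 2 + s ^ 2)⁻¹)) l (nhds 0) := by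
    have := (Real.continuous_sqrt.tendsto 0).comp h0
    rwa [Real.sqrt_zero] at this
  refine squeeze_zero_norm (fun s => ?_) h1
  rw [Real.norm_eq_abs]
  exact Real.abs_le_sqrt (sq_hilbertKernel_le hy s)

/-- The quotient of the two arguments is `1` plus terms that vanish at infinity. This removes the
logarithms from the boundary values of the primitive used next. -/
theorem tendsto_log_ratio {y a b : ℝ} (hy : 0 < y) {l : Filter ℝ}
    (hl : Filter.Tendsto (fun x : ℝ => |x - b|) l Filter.atTop) :
    Filter.Tendsto (fun x : ℝ => Real.log (y ^ 2 + (x - a) ^ 2) - Real.log (y ^ 2 + (x - b) ^ 2))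
      l (nhds 0) := by
  have hl' : Filter.Tendsto (fun x : ℝ => |x|) (l.map fun x => x - b) Filter.atTop := by
    rwa [Filter.tendsto_map'_iff]
  obtain ⟨h1, h2⟩ := tendsto_hilbertKernel hy hl'
  rw [Filter.tendsto_map'_iff] at h1 h2
  have h3 : Filter.Tendsto (fun x => 1 + (-(2 * (a - b)) * hilbertKernel y (x - b) +
      (a - b) ^ 2 * (y ^ 2 + (x - b) ^ 2)⁻¹)) l (nhds (1 + (-(2 * (a - b)) * 0 +
      (a - b) ^ 2 * 0))) :=
    ((h1.const_mul _).add (h2.const_mul _)).const_add 1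
  have h4 := (Real.continuousAt_log (x := 1) one_ne_zero).tendsto
  have h5 : (1 : ℝ) + (-(2 * (a - b)) * 0 + (a - b) ^ 2 * 0) = 1 := by ring
  rw [h5] at h3
  have h6 := h4.comp h3
  rw [Real.log_one] at h6
  refine h6.congr fun x => ?_
  have p1 : 0 < y ^ 2 + (x - a) ^ 2 := by positivity
  have p2 : 0 < y ^ 2 + (x - b) ^ 2 := by positivity
  rw [← Real.log_div p1.ne' p2.ne']
  simp only [Function.comp, hilbertKernel]
  congr 1
  field_simp
  ring

/-- Partial fractions give a primitive from logarithms and arctangents; only the arctangents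
contribute at infinity. The result is a Poisson kernel at height `2y`, whose total mass in `a - b`
is `π²`, independent of `y`. -/
theorem integral_hilbertKernel_mul {y a b : ℝ} (hy : 0 < y) (hab : a ≠ b) :
    ∫ x, hilbertKernel y (x - a) * hilbertKernel y (x - b) =
      2 * Real.pi * y * ((2 * y) ^ 2 + (a - b) ^ 2)⁻¹ := by
  have hd : a - b ≠ 0 := sub_ne_zero.2 hab
  have hW : 0 < (2 * y) ^ 2 + (a - b) ^ 2 := by positivity
  set W := (2 * y) ^ 2 + (a - b) ^ 2 with hWdef
  set F : ℝ → ℝ := fun x => ((a - b) ^ 2 + 2 * y ^ 2) / (2 * (a - b) * W) *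
    (Real.log (y ^ 2 + (x - a) ^ 2) - Real.log (y ^ 2 + (x - b) ^ 2)) +
    y / W * (Real.arctan ((x - a) / y) + Real.arctan ((x - b) / y)) with hF
  have hder : ∀ x, HasDerivAt F (hilbertKernel y (x - a) * hilbertKernel y (x - b)) x := by
    intro x
    have hlog : ∀ c, HasDerivAt (fun x => Real.log (y ^ 2 + (x - c) ^ 2))
        (2 * (x - c) / (y ^ 2 + (x - c) ^ 2)) x := fun c => by
      have h1 : HasDerivAt (fun x : ℝ => y ^ 2 + (x - c) ^ 2) (2 * (x - c)) x := by
        simpa using (((hasDerivAt_id x).sub_const c).pow 2).const_add (y ^ 2)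
      exact h1.log (by positivity)
    have hat : ∀ c, HasDerivAt (fun x => Real.arctan ((x - c) / y))
        (1 / (1 + ((x - c) / y) ^ 2) * (1 / y)) x := fun c =>
      (((hasDerivAt_id x).sub_const c).div_const y).arctan
    refine ((((hlog a).sub (hlog b)).const_mul _).add
      (((hat a).add (hat b)).const_mul _)).congr_deriv ?_
    have p1 : 0 < y ^ 2 + (x - a) ^ 2 := by positivity
    have p2 : 0 < y ^ 2 + (x - b) ^ 2 := by positivity
    have q : ∀ c, 1 / (1 + ((x - c) / y) ^ 2) * (1 / y) = y / (y ^ 2 + (x - c) ^ 2) := fun c => by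
      have : 0 < y ^ 2 + (x - c) ^ 2 := by positivity
      field_simp
    rw [q, q, hilbertKernel, hilbertKernel]
    field_simp
    rw [hWdef]
    ring
  have hat : Filter.Tendsto (fun x : ℝ => |x|) Filter.atTop Filter.atTop :=
    Filter.tendsto_abs_atTop_atTop
  have hab' : Filter.Tendsto (fun x : ℝ => |x|) Filter.atBot Filter.atTop :=
    Filter.tendsto_abs_atBot_atTop
  have hsubT : ∀ c : ℝ, Filter.Tendsto (fun x => x - c) Filter.atTop Filter.atTop := fun c =>
    Filter.tendsto_atTop_add_const_right _ (-c) Filter.tendsto_id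
  have hsubB : ∀ c : ℝ, Filter.Tendsto (fun x => x - c) Filter.atBot Filter.atBot := fun c =>
    Filter.tendsto_atBot_add_const_right _ (-c) Filter.tendsto_id
  have harT : ∀ c : ℝ, Filter.Tendsto (fun x => Real.arctan ((x - c) / y)) Filter.atTop
      (nhds (Real.pi / 2)) := fun c =>
    (tendsto_nhds_of_tendsto_nhdsWithin Real.tendsto_arctan_atTop).comp
      ((hsubT c).atTop_div_const hy)
  have harB : ∀ c : ℝ, Filter.Tendsto (fun x => Real.arctan ((x - c) / y)) Filter.atBot
      (nhds (-(Real.pi / 2))) := fun c =>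
    (tendsto_nhds_of_tendsto_nhdsWithin Real.tendsto_arctan_atBot).comp
      ((hsubB c).atBot_div_const hy)
  have hT := ((tendsto_log_ratio (a := a) hy (hat.comp (hsubT b))).const_mul
    (((a - b) ^ 2 + 2 * y ^ 2) / (2 * (a - b) * W))).add
    (((harT a).add (harT b)).const_mul (y / W))
  have hB := ((tendsto_log_ratio (a := a) hy (hab'.comp (hsubB b))).const_mul
    (((a - b) ^ 2 + 2 * y ^ 2) / (2 * (a - b) * W))).add
    (((harB a).add (harB b)).const_mul (y / W))
  rw [integral_of_hasDerivAt_of_tendsto hder (integrable_hilbertKernel_mul hy a b) hB hT]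
  field_simp
  ring

/-- The conjugate Poisson integral is bounded from `L¹ ∩ L^∞` to `L²`, uniformly in `y`. -/
theorem integral_norm_sq_hilbert_le {y B : ℝ} (hy : 0 < y) {f : ℝ → ℂ}
    (hfm : Measurable f) (hfB : ∀ t, ‖f t‖ ≤ B) (hf : Integrable f) :
    Integrable (fun x => ‖∫ t, ((hilbertKernel y (x - t) : ℝ) : ℂ) * f t‖ ^ 2) ∧
      ∫ x, ‖∫ t, ((hilbertKernel y (x - t) : ℝ) : ℂ) * f t‖ ^ 2 ≤
        Real.pi ^ 2 * B * ∫ t, ‖f t‖ := by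
  -- The square is written as a double integral over `(t, s)` and the `x` integral is done first;
  -- this replaces the Fourier transform.
  have hc := (continuous_hilbertKernel hy).measurable
  set F : ℝ → ℝ × ℝ → ℂ := fun x z =>
    (((hilbertKernel y (x - z.1) : ℝ) : ℂ) * f z.1) *
      (((hilbertKernel y (x - z.2) : ℝ) : ℂ) * (starRingEnd ℂ) (f z.2)) with hF
  have hFn : ∀ x z, ‖F x z‖ = |hilbertKernel y (x - z.1) * hilbertKernel y (x - z.2)| *
      (‖f z.1‖ * ‖f z.2‖) := fun x z => by
    simp only [hF, norm_mul, Complex.norm_real, Real.norm_eq_abs, RCLike.norm_conj, abs_mul]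
    ring
  have hff : Integrable (fun z : ℝ × ℝ => ‖f z.1‖ * ‖f z.2‖) (volume.prod volume) :=
    hf.norm.mul_prod hf.norm
  have hFm : Measurable (Function.uncurry F) := by
    have hconj : Measurable (starRingEnd ℂ) := Complex.continuous_conj.measurable
    refine Measurable.mul (Measurable.mul ?_ ?_) (Measurable.mul ?_ ?_)
    · exact Complex.measurable_ofReal.comp (hc.comp (by fun_prop))
    · exact hfm.comp (by fun_prop)
    · exact Complex.measurable_ofReal.comp (hc.comp (by fun_prop))
    · exact hconj.comp (hfm.comp (by fun_prop))
  have hslice : ∀ z : ℝ × ℝ, Integrable (fun x => F x z) := fun z => by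
    have h : Integrable fun x : ℝ =>
        ((hilbertKernel y (x - z.1) * hilbertKernel y (x - z.2) : ℝ) : ℂ) *
        (f z.1 * (starRingEnd ℂ) (f z.2)) :=
      Integrable.mul_const (integrable_hilbertKernel_mul hy z.1 z.2).ofReal _
    refine h.congr (Filter.Eventually.of_forall fun x => ?_)
    simp only [hF]; push_cast; ring
  have hg := integrable_inv_sq_add_sq hy
  -- Only qualitative, for Fubini: the majorant `π / y` blows up as `y → 0` and does not enter the
  -- final constant.
  have hFint : Integrable (Function.uncurry F) (volume.prod (volume.prod volume)) := by
    rw [integrable_prod_iff' hFm.aestronglyMeasurable]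
    refine ⟨Filter.Eventually.of_forall fun z => hslice z, ?_⟩
    refine Integrable.mono' (hff.const_mul (Real.pi / y))
      hFm.norm.stronglyMeasurable.integral_prod_left'.aestronglyMeasurable ?_
    refine Filter.Eventually.of_forall fun z => ?_
    rw [Real.norm_of_nonneg (integral_nonneg fun x => norm_nonneg _)]
    simp only [Function.uncurry, hFn]
    rw [integral_mul_const]
    gcongr
    calc ∫ x, |hilbertKernel y (x - z.1) * hilbertKernel y (x - z.2)|
        ≤ ∫ x, (1 / 2) * ((y ^ 2 + (x - z.1) ^ 2)⁻¹ + (y ^ 2 + (x - z.2) ^ 2)⁻¹) := by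
          refine integral_mono (integrable_hilbertKernel_mul hy z.1 z.2).abs
            (((hg.comp_sub_right _).add (hg.comp_sub_right _)).const_mul _) fun x => ?_
          exact abs_hilbertKernel_mul_le hy _ _
      _ = Real.pi / y := by
          rw [integral_const_mul, integral_add (hg.comp_sub_right _) (hg.comp_sub_right _),
            integral_sub_right_eq_self (fun x : ℝ => (y ^ 2 + x ^ 2)⁻¹),
            integral_sub_right_eq_self (fun x : ℝ => (y ^ 2 + x ^ 2)⁻¹),
            integral_univ_inv_sq_add_sq hy]
          ring
  have hsq : ∀ x, ((‖∫ t, ((hilbertKernel y (x - t) : ℝ) : ℂ) * f t‖ ^ 2 : ℝ) : ℂ) =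
      ∫ z, F x z ∂(volume.prod volume) := fun x => by
    rw [hF, integral_prod_mul (fun t => ((hilbertKernel y (x - t) : ℝ) : ℂ) * f t)
      (fun t => ((hilbertKernel y (x - t) : ℝ) : ℂ) * (starRingEnd ℂ) (f t))]
    have : ∫ t, ((hilbertKernel y (x - t) : ℝ) : ℂ) * (starRingEnd ℂ) (f t) =
        (starRingEnd ℂ) (∫ t, ((hilbertKernel y (x - t) : ℝ) : ℂ) * f t) := by
      rw [← integral_conj]
      simp
    rw [this, Complex.mul_conj, Complex.normSq_eq_norm_sq]
  have hint : Integrable (fun x => ‖∫ t, ((hilbertKernel y (x - t) : ℝ) : ℂ) * f t‖ ^ 2) := by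
    have h := hFint.integral_prod_left.norm
    refine h.congr (Filter.Eventually.of_forall fun x => ?_)
    simp only [Function.uncurry]
    rw [← hsq, Complex.norm_real, Real.norm_of_nonneg (by positivity)]
  refine ⟨hint, ?_⟩
  have h2y : 0 < 2 * y := by positivity
  have hG := integrable_inv_sq_add_sq h2y
  have hB0 : 0 ≤ B := (norm_nonneg _).trans (hfB 0)
  have hval : ∀ᵐ z : ℝ × ℝ ∂(volume.prod volume), ‖∫ x, F x z‖ ≤
      ‖f z.1‖ * (B * (2 * Real.pi * y * ((2 * y) ^ 2 + (z.1 - z.2) ^ 2)⁻¹)) := by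
    have hne : ∀ᵐ z : ℝ × ℝ ∂(volume.prod volume), z.1 ≠ z.2 := by
      refine (Measure.ae_prod_iff_ae_ae (measurableSet_eq_fun measurable_fst
        measurable_snd).compl).2 (Filter.Eventually.of_forall fun a => ?_)
      filter_upwards [compl_mem_ae_iff.2 (measure_singleton (μ := (volume : Measure ℝ)) a)]
        with b hb h
      exact hb h.symm
    filter_upwards [hne] with z hz
    have e : ∫ x, F x z = ((∫ x, hilbertKernel y (x - z.1) * hilbertKernel y (x - z.2) : ℝ) : ℂ) *
        (f z.1 * (starRingEnd ℂ) (f z.2)) := by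
      rw [← integral_complex_ofReal, ← integral_mul_const]
      congr 1; ext x; simp only [hF]; push_cast; ring
    rw [e, integral_hilbertKernel_mul hy hz]
    rw [norm_mul, norm_mul, Complex.norm_real, RCLike.norm_conj,
      Real.norm_of_nonneg (r := 2 * Real.pi * y * ((2 * y) ^ 2 + (z.1 - z.2) ^ 2)⁻¹)
      (by positivity)]
    calc _ = ‖f z.1‖ * (‖f z.2‖ * (2 * Real.pi * y * ((2 * y) ^ 2 + (z.1 - z.2) ^ 2)⁻¹)) := by ring
      _ ≤ _ := by gcongr; exact hfB _
  have hdomm : Integrable (fun z : ℝ × ℝ =>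
      ‖f z.1‖ * (B * (2 * Real.pi * y * ((2 * y) ^ 2 + (z.1 - z.2) ^ 2)⁻¹)))
      (volume.prod volume) := by
    rw [integrable_prod_iff]
    · refine ⟨Filter.Eventually.of_forall fun t => ?_, ?_⟩
      · exact (((hG.comp_sub_left t).const_mul (2 * Real.pi * y)).const_mul B).const_mul ‖f t‖
      · have : ∀ t, ∫ s, ‖‖f t‖ * (B * (2 * Real.pi * y * ((2 * y) ^ 2 + (t - s) ^ 2)⁻¹))‖ =
            ‖f t‖ * (B * Real.pi ^ 2) := fun t => by
          have h0 : ∀ s, ‖‖f t‖ * (B * (2 * Real.pi * y * ((2 * y) ^ 2 + (t - s) ^ 2)⁻¹))‖ =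
              ‖f t‖ * (B * (2 * Real.pi * y)) * ((2 * y) ^ 2 + (t - s) ^ 2)⁻¹ := fun s => by
            rw [Real.norm_of_nonneg (by positivity)]; ring
          simp only [h0]
          rw [integral_const_mul,
            integral_sub_left_eq_self (fun x : ℝ => ((2 * y) ^ 2 + x ^ 2)⁻¹),
            integral_univ_inv_sq_add_sq h2y]
          field_simp
        simp only [this]
        exact hf.norm.mul_const _
    · refine Measurable.aestronglyMeasurable ?_
      have := hfm.norm
      exact (this.comp measurable_fst).mul (by fun_prop)
  have hstep : ((∫ x, ‖∫ t, ((hilbertKernel y (x - t) : ℝ) : ℂ) * f t‖ ^ 2 : ℝ) : ℂ) =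
      ∫ z, (∫ x, F x z) ∂(volume.prod volume) := by
    rw [← integral_complex_ofReal, ← integral_integral_swap hFint]
    congr 1; ext x; exact hsq x
  have hnn : 0 ≤ ∫ x, ‖∫ t, ((hilbertKernel y (x - t) : ℝ) : ℂ) * f t‖ ^ 2 :=
    integral_nonneg fun x => by positivity
  rw [← Real.norm_of_nonneg hnn, ← Complex.norm_real, hstep]
  refine (norm_integral_le_of_norm_le hdomm hval).trans (le_of_eq ?_)
  rw [integral_prod _ hdomm]
  have : ∀ t, ∫ s, ‖f t‖ * (B * (2 * Real.pi * y * ((2 * y) ^ 2 + (t - s) ^ 2)⁻¹)) =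
      ‖f t‖ * (B * Real.pi ^ 2) := fun t => by
    rw [integral_const_mul, integral_const_mul, integral_const_mul,
      integral_sub_left_eq_self (fun x : ℝ => ((2 * y) ^ 2 + x ^ 2)⁻¹),
      integral_univ_inv_sq_add_sq h2y]
    field_simp
  simp only [this]
  rw [integral_mul_const]
  ring

/-! ### Polynomial approximation of the kernel and vanishing moments. -/

/-- Taylor expansion near `0`, compactness elsewhere. The interval is the range of `2τ + τ²`-type
increments for `|τ| ≤ 2/3`: `-4/3 + 4/9 = -8/9` and `4/3 + 4/9 = 16/9`. -/
theorem exists_abs_rpow_sub_sum_le (a : ℝ) (n : ℕ) :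
    ∃ c : ℕ → ℝ, ∃ C : ℝ, 0 < C ∧ ∀ z ∈ Set.Icc (-(8 / 9) : ℝ) (16 / 9),
      |(1 + z) ^ a - ∑ k ∈ Finset.range n, c k * z ^ k| ≤ C * |z| ^ n := by
  have han : AnalyticAt ℝ (fun z : ℝ => (1 + z) ^ a) 0 := by
    have h1 : AnalyticAt ℝ (fun z : ℝ => 1 + z) 0 := analyticAt_const.add analyticAt_id
    have h2 : AnalyticAt ℝ (fun z : ℝ => Real.exp (Real.log (1 + z) * a)) 0 :=
      ((h1.log (by norm_num)).mul analyticAt_const).rexp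
    refine h2.congr ?_
    filter_upwards [Ioi_mem_nhds (show (-1 : ℝ) < 0 by norm_num)] with z hz
    rw [Real.rpow_def_of_pos (by linarith [Set.mem_Ioi.1 hz])]
  obtain ⟨p, hp⟩ := han
  have hO := hp.isBigO_sub_partialSum_pow n
  have hps : ∀ z : ℝ, p.partialSum n z = ∑ k ∈ Finset.range n, p.coeff k * z ^ k := fun z => by
    simp only [FormalMultilinearSeries.partialSum, FormalMultilinearSeries.apply_eq_pow_smul_coeff,
      smul_eq_mul, mul_comm]
  simp only [zero_add, hps] at hO
  obtain ⟨C1, hC1, hb⟩ := hO.exists_pos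
  rw [Asymptotics.isBigOWith_iff, Metric.eventually_nhds_iff] at hb
  obtain ⟨ε, hε, hb⟩ := hb
  have hcont : ContinuousOn (fun z : ℝ => (1 + z) ^ a - ∑ k ∈ Finset.range n, p.coeff k * z ^ k)
      (Set.Icc (-(8 / 9) : ℝ) (16 / 9)) := by
    refine ContinuousOn.sub ?_ (by fun_prop)
    exact ContinuousOn.rpow_const (by fun_prop) fun z hz => Or.inl (by linarith [hz.1])
  obtain ⟨C2, hC2⟩ := isCompact_Icc.exists_bound_of_continuousOn hcont
  have hεn : 0 < ε ^ n := by positivity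
  refine ⟨p.coeff, C1 + |C2| / ε ^ n, by positivity, fun z hz => ?_⟩
  rcases lt_or_ge |z| ε with h | h
  · have h1 := hb (y := z) (by simpa [Real.dist_eq] using h)
    simp only [Real.norm_eq_abs, abs_pow, abs_abs] at h1
    refine h1.trans ?_
    gcongr
    linarith [div_nonneg (abs_nonneg C2) hεn.le]
  · have h1 := hC2 z hz
    rw [Real.norm_eq_abs] at h1
    have h2 : ε ^ n ≤ |z| ^ n := by gcongr
    calc _ ≤ |C2| := h1.trans (le_abs_self _)
      _ = |C2| / ε ^ n * ε ^ n := by field_simp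
      _ ≤ (C1 + |C2| / ε ^ n) * |z| ^ n := by gcongr; linarith

theorem sq_abs_sub_one_le_kernelDen {y x u : ℝ} (hu : u ∈ Set.Ioo (0 : ℝ) 1) :
    (|x| - 1) ^ 2 ≤ kernelDen y x 1 u := by
  have h1 := hu.1
  have h2 : 0 < 1 - u := by linarith [hu.2]
  have h3 : (|x| - 1) ^ 2 ≤ (x - 1) ^ 2 := by nlinarith [le_abs_self x, sq_abs x]
  have h4 : (|x| - 1) ^ 2 ≤ (x + 1) ^ 2 := by nlinarith [neg_abs_le x, sq_abs x]
  unfold kernelDen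
  nlinarith [mul_le_mul_of_nonneg_left h3 h2.le, mul_le_mul_of_nonneg_left h4 h1.le, sq_nonneg y]

/-- Relative increments of a quadratic `g² + 2 s b + s²` with `|b| ≤ g`, `|s| ≤ 2 g / 3`. -/
theorem quadratic_increment_bounds {g b s d r : ℝ} (hr : 0 < r) (hrg : r ≤ g) (hb : |b| ≤ g)
    (hs : |s| ≤ d) (hd : 3 / 2 * d ≤ r) :
    (2 * s * b + s ^ 2) / g ^ 2 ∈ Set.Icc (-(8 / 9) : ℝ) (16 / 9) ∧
      |(2 * s * b + s ^ 2) / g ^ 2| ≤ 3 * (d / r) := by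
  have hg : 0 < g := hr.trans_le hrg
  have hsb : |s * b| ≤ |s| * g := by rw [abs_mul]; gcongr
  have h1 := abs_le.1 hsb
  have h2 : s ^ 2 = |s| ^ 2 := (sq_abs s).symm
  have h3 : 0 ≤ |s| := abs_nonneg s
  have h4 : |s| ≤ 2 / 3 * g := by linarith
  refine ⟨⟨?_, ?_⟩, ?_⟩
  · rw [le_div_iff₀ (by positivity)]
    nlinarith [mul_nonneg (by linarith : 0 ≤ 2 / 3 * g - |s|) (by linarith : 0 ≤ 4 / 3 * g - |s|)]
  · rw [div_le_iff₀ (by positivity)]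
    nlinarith [mul_nonneg (by linarith : 0 ≤ 2 / 3 * g - |s|) h3]
  · rw [abs_div, abs_of_pos (by positivity : 0 < g ^ 2), div_le_iff₀ (by positivity)]
    have h5 : |2 * s * b + s ^ 2| ≤ 3 * d * g := by
      rw [abs_le]
      constructor <;> nlinarith [mul_nonneg (by linarith : 0 ≤ 2 / 3 * g - |s|) h3,
        mul_le_mul_of_nonneg_right hs hg.le]
    have h6 : d * g ≤ d / r * g ^ 2 := by
      have hd0 : 0 ≤ d := h3.trans hs
      have : d / r * g ^ 2 = d * g * (g / r) := by ring
      rw [this]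
      exact le_mul_of_one_le_right (by positivity) ((one_le_div hr).2 hrg)
    linarith

theorem natDegree_sum_C_mul_pow_le {Z : Polynomial ℝ} (hZ : Z.natDegree ≤ 2) (c : ℕ → ℝ) (n : ℕ) :
    (∑ k ∈ Finset.range n, Polynomial.C (c k) * Z ^ k).natDegree ≤ 2 * (n - 1) := by
  refine Polynomial.natDegree_sum_le_of_forall_le _ _ fun k hk => ?_
  refine (Polynomial.natDegree_C_mul_le _ _).trans (Polynomial.natDegree_pow_le.trans ?_)
  have := Finset.mem_range.1 hk
  calc k * Z.natDegree ≤ (n - 1) * 2 := Nat.mul_le_mul (by omega) hZ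
    _ = _ := by ring

/-- Polynomial approximation of the kernel in its second variable, away from the diagonal. -/
theorem exists_polynomial_kernel_approx (a : ℝ) (N : ℕ) :
    ∃ C : ℝ, 0 < C ∧ ∀ y x u d : ℝ, 0 < y → u ∈ Set.Ioo (0 : ℝ) 1 → 0 < d →
      3 / 2 * d ≤ |(|x| - 1)| → ∃ P : Polynomial ℝ, P.natDegree ≤ 2 * N ∧
        ∀ t : ℝ, |t - 1| < d → |(x - t) * kernelDen y x t u ^ a - P.eval t| ≤
          C * (d / |(|x| - 1)|) ^ (N + 1) * (|x - 1| * kernelDen y x 1 u ^ a) := by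
  obtain ⟨c1, C1, hC1, h1⟩ := exists_abs_rpow_sub_sum_le a (N + 1)
  obtain ⟨c2, C2, hC2, h2⟩ := exists_abs_rpow_sub_sum_le a N
  refine ⟨C1 * 3 ^ (N + 1) + C2 * 3 ^ N, by positivity, fun y x u d hy hu hd hr => ?_⟩
  set r := |(|x| - 1)| with hrdef
  have hr0 : 0 < r := by linarith
  have hG := kernelDen_pos (x := x) (t := 1) hy hu
  set G := kernelDen y x 1 u with hGdef
  set g := Real.sqrt G with hg
  have hgG : g ^ 2 = G := Real.sq_sqrt hG.le
  have hrg : r ≤ g := Real.abs_le_sqrt (sq_abs_sub_one_le_kernelDen hu)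
  -- Half the `t`-derivative of the denominator at `t = 1`. The bound `|b| ≤ g` below holds since `G
  -- - b² = y² + 4u(1 - u)x²`.
  set b := 1 - x * (1 - 2 * u) with hb
  have hbg : |b| ≤ g := by
    refine Real.abs_le_sqrt ?_
    rw [hGdef, hb]; unfold kernelDen
    nlinarith [mul_nonneg (mul_pos hu.1 (by linarith [hu.2] : 0 < 1 - u)).le (sq_nonneg x),
      sq_nonneg y]
  set Z : Polynomial ℝ := Polynomial.C (G⁻¹) * (Polynomial.C (2 * b) * (Polynomial.X -
    Polynomial.C 1) + (Polynomial.X - Polynomial.C 1) ^ 2) with hZ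
  have hX1 : (Polynomial.X - Polynomial.C (1 : ℝ)).natDegree ≤ 1 := by
    rw [Polynomial.natDegree_X_sub_C]
  have hZd : Z.natDegree ≤ 2 := by
    refine (Polynomial.natDegree_C_mul_le _ _).trans (Polynomial.natDegree_add_le_of_degree_le
      ((Polynomial.natDegree_C_mul_le _ _).trans (hX1.trans one_le_two)) ?_)
    exact Polynomial.natDegree_pow_le.trans (by omega)
  have hZe : ∀ t, Z.eval t = (2 * (t - 1) * b + (t - 1) ^ 2) / g ^ 2 := fun t => by
    rw [hgG, hZ]; simp; ring
  have hS2 : ((Polynomial.X - Polynomial.C (1 : ℝ)) *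
      ∑ k ∈ Finset.range N, Polynomial.C (c2 k) * Z ^ k).natDegree ≤ 2 * N := by
    rcases Nat.eq_zero_or_pos N with h | h
    · simp [h]
    · refine Polynomial.natDegree_mul_le.trans ?_
      have := natDegree_sum_C_mul_pow_le hZd c2 N
      omega
  -- The factor `x - t` is split as `(x - 1) - (t - 1)`. The second sum stops one term earlier: `t -
  -- 1` already brings a factor `d/r` relative to `x - 1`, and the shorter sum keeps the degree
  -- within `2N`.
  refine ⟨Polynomial.C (G ^ a) * (Polynomial.C (x - 1) *
    ∑ k ∈ Finset.range (N + 1), Polynomial.C (c1 k) * Z ^ k - (Polynomial.X - Polynomial.C 1) *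
    ∑ k ∈ Finset.range N, Polynomial.C (c2 k) * Z ^ k), ?_, fun t ht => ?_⟩
  · refine (Polynomial.natDegree_C_mul_le _ _).trans ((Polynomial.natDegree_sub_le _ _).trans
      (max_le ((Polynomial.natDegree_C_mul_le _ _).trans ?_) hS2))
    simpa using natDegree_sum_C_mul_pow_le hZd c1 (N + 1)
  · obtain ⟨hz1, hz2⟩ := quadratic_increment_bounds hr0 hrg hbg ht.le hr
    rw [← hZe] at hz1 hz2
    set z := Z.eval t with hz
    have hGt : kernelDen y x t u = G * (1 + z) := by
      have : G * (1 + z) = G + (2 * (t - 1) * b + (t - 1) ^ 2) := by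
        rw [hz, hZe, hgG]; field_simp
      rw [this, hGdef, hb]
      unfold kernelDen; ring
    have hev : (Polynomial.C (G ^ a) * (Polynomial.C (x - 1) *
        ∑ k ∈ Finset.range (N + 1), Polynomial.C (c1 k) * Z ^ k -
        (Polynomial.X - Polynomial.C 1) *
        ∑ k ∈ Finset.range N, Polynomial.C (c2 k) * Z ^ k)).eval t =
        G ^ a * ((x - 1) * ∑ k ∈ Finset.range (N + 1), c1 k * z ^ k -
          (t - 1) * ∑ k ∈ Finset.range N, c2 k * z ^ k) := by
      simp [Polynomial.eval_finsetSum, hz]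
    have hGa : 0 < G ^ a := by positivity
    have e : (x - t) * (G ^ a * (1 + z) ^ a) -
        G ^ a * ((x - 1) * ∑ k ∈ Finset.range (N + 1), c1 k * z ^ k -
          (t - 1) * ∑ k ∈ Finset.range N, c2 k * z ^ k) =
        G ^ a * ((x - 1) * ((1 + z) ^ a - ∑ k ∈ Finset.range (N + 1), c1 k * z ^ k) -
          (t - 1) * ((1 + z) ^ a - ∑ k ∈ Finset.range N, c2 k * z ^ k)) := by ring
    have hrx : r ≤ |x - 1| := by
      have := abs_abs_sub_abs_le_abs_sub x 1
      rwa [abs_one] at this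
    rw [hev, hGt, Real.mul_rpow hG.le (by linarith [hz1.1]), e, abs_mul, abs_of_pos hGa]
    have hq : 0 < d / r := by positivity
    have hA : |(x - 1) * ((1 + z) ^ a - ∑ k ∈ Finset.range (N + 1), c1 k * z ^ k)| ≤
        |x - 1| * (C1 * (3 * (d / r)) ^ (N + 1)) := by
      rw [abs_mul]
      gcongr
      exact (h1 z hz1).trans (by gcongr)
    have hB : |(t - 1) * ((1 + z) ^ a - ∑ k ∈ Finset.range N, c2 k * z ^ k)| ≤
        |x - 1| * (d / r) * (C2 * (3 * (d / r)) ^ N) := by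
      rw [abs_mul]
      have : |t - 1| ≤ |x - 1| * (d / r) := by
        refine ht.le.trans ?_
        rw [← mul_div_assoc, le_div_iff₀ hr0, mul_comm]
        gcongr
      gcongr
      exact (h2 z hz1).trans (by gcongr)
    calc _ ≤ G ^ a * (|x - 1| * (C1 * (3 * (d / r)) ^ (N + 1)) +
          |x - 1| * (d / r) * (C2 * (3 * (d / r)) ^ N)) := by
          gcongr
          exact (abs_sub _ _).trans (add_le_add hA hB)
      _ = _ := by rw [mul_pow, mul_pow]; ring

theorem integral_polynomial_mul_eq_zero {f : ℝ → ℂ} {n : ℕ}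
    (hint : ∀ k : ℕ, Integrable fun t : ℝ => (t : ℂ) ^ k * f t)
    (h : ∀ k ≤ n, ∫ t : ℝ, (t : ℂ) ^ k * f t = 0) {P : Polynomial ℝ} (hP : P.natDegree ≤ n) :
    Integrable (fun t : ℝ => ((P.eval t : ℝ) : ℂ) * f t) ∧
      ∫ t : ℝ, ((P.eval t : ℝ) : ℂ) * f t = 0 := by
  have e : (fun t : ℝ => ((P.eval t : ℝ) : ℂ) * f t) = fun t : ℝ =>
      ∑ k ∈ Finset.range (P.natDegree + 1), (P.coeff k : ℂ) * ((t : ℂ) ^ k * f t) := by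
    ext t
    rw [Polynomial.eval_eq_sum_range, Complex.ofReal_sum, Finset.sum_mul]
    refine Finset.sum_congr rfl fun k _ => ?_
    push_cast; ring
  rw [e]
  refine ⟨integrable_finsetSum _ fun k _ => (hint k).const_mul _, ?_⟩
  rw [integral_finsetSum _ fun k _ => (hint k).const_mul _]
  refine Finset.sum_eq_zero fun k hk => ?_
  rw [integral_const_mul, h k (by have := Finset.mem_range.1 hk; omega), mul_zero]

/-! ### The operator and its pointwise bounds in the three regions. -/

/-- The integral operator with kernel `(x - t) * reducedKernel lam y x t`. -/
noncomputable def reducedIntegral (lam y : ℝ) (f : ℝ → ℂ) (x : ℝ) : ℂ :=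
  ∫ t, f t * (((x - t) * reducedKernel lam y x t : ℝ) : ℂ)

theorem measurable_reducedKernel (lam y : ℝ) :
    Measurable fun z : ℝ × ℝ => reducedKernel lam y z.1 z.2 := by
  have h : Measurable fun w : (ℝ × ℝ) × ℝ => w.2 ^ (lam - 1) * (1 - w.2) ^ lam *
      kernelDen y w.1.1 w.1.2 w.2 ^ (-(lam + 1)) := by
    unfold kernelDen; fun_prop
  exact (h.stronglyMeasurable.integral_prod_right (ν := volume.restrict (Set.Ioo (0 : ℝ) 1))).measurable

theorem measurable_reducedIntegral (lam y : ℝ) {f : ℝ → ℂ} (hf : Measurable f) :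
    Measurable (reducedIntegral lam y f) := by
  have h : Measurable fun z : ℝ × ℝ =>
      f z.2 * (((z.1 - z.2) * reducedKernel lam y z.1 z.2 : ℝ) : ℂ) := by
    refine (hf.comp measurable_snd).mul (Complex.measurable_ofReal.comp ?_)
    exact (measurable_fst.sub measurable_snd).mul (measurable_reducedKernel lam y)
  exact (h.stronglyMeasurable.integral_prod_right (ν := volume)).measurable

/-- A crude bound depending on `y`, used only for integrability. -/
theorem reducedKernel_le_const {lam y x t : ℝ} (hlam : 0 < lam) (hy : 0 < y) :
    reducedKernel lam y x t ≤ 1 / (lam * y ^ 2 * (y ^ 2) ^ lam) := by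
  refine (reducedKernel_le_of_ne hlam hy).trans ?_
  gcongr <;> nlinarith [sq_nonneg (x - t), sq_nonneg (x + t)]

theorem integrable_of_bounded_of_support {c d B : ℝ} {f : ℝ → ℂ} (hf : AEStronglyMeasurable f)
    (hB : ∀ t ∈ Metric.ball c d, ‖f t‖ ≤ B) (hs : ∀ t ∉ Metric.ball c d, f t = 0) :
    Integrable f := by
  rw [← integrableOn_iff_integrable_of_support_subset (s := Metric.ball c d)]
  · refine Measure.integrableOn_of_bounded (M := B) measure_ball_lt_top.ne hf ?_
    filter_upwards [ae_restrict_mem measurableSet_ball] with t ht using hB t ht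
  · intro t ht
    by_contra h
    exact ht (hs t h)

theorem norm_integral_le_of_support {c d B : ℝ} {f : ℝ → ℂ} (hd : 0 < d)
    (hB : ∀ t ∈ Metric.ball c d, ‖f t‖ ≤ B) (hs : ∀ t ∉ Metric.ball c d, f t = 0) :
    ‖∫ t, f t‖ ≤ B * (2 * d) := by
  rw [← setIntegral_eq_integral_of_forall_compl_eq_zero hs]
  refine (norm_setIntegral_le_of_norm_le_const measure_ball_lt_top hB).trans ?_
  rw [Measure.real, Real.volume_ball, ENNReal.toReal_ofReal (by linarith)]

theorem integrable_mul_of_support {c d B : ℝ} {f g : ℝ → ℂ} (hf : Measurable f) (hg : Continuous g)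
    (hB : ∀ t, ‖f t‖ ≤ B) (hs : ∀ t ∉ Metric.ball c d, f t = 0) :
    Integrable fun t => g t * f t := by
  obtain ⟨M, hM⟩ := (isCompact_closedBall c d).exists_bound_of_continuousOn hg.continuousOn
  refine integrable_of_bounded_of_support (c := c) (d := d) (B := M * B)
    (hg.measurable.mul hf).aestronglyMeasurable (fun t ht => ?_) fun t ht => by simp [hs t ht]
  have h1 := hM t (Metric.ball_subset_closedBall ht)
  rw [norm_mul]
  exact mul_le_mul h1 (hB t) (norm_nonneg _) ((norm_nonneg _).trans h1)

theorem integrable_reducedIntegral {lam y x c d B : ℝ} (hlam : 0 < lam) (hy : 0 < y) {f : ℝ → ℂ}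
    (hf : Measurable f) (hB : ∀ t, ‖f t‖ ≤ B) (hs : ∀ t ∉ Metric.ball c d, f t = 0) :
    Integrable fun t => f t * (((x - t) * reducedKernel lam y x t : ℝ) : ℂ) := by
  have h0 := integrable_mul_of_support (g := fun t => ((x - t : ℝ) : ℂ)) hf (by fun_prop) hB hs
  have hk : Measurable fun t => reducedKernel lam y x t :=
    (measurable_reducedKernel lam y).comp (g := fun z : ℝ × ℝ => reducedKernel lam y z.1 z.2)
      (f := fun t : ℝ => (x, t)) measurable_prodMk_left
  have hkm : AEStronglyMeasurable (fun t => ((reducedKernel lam y x t : ℝ) : ℂ)) volume :=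
    (Complex.measurable_ofReal.comp hk).aestronglyMeasurable
  have hkb : ∀ t, ‖((reducedKernel lam y x t : ℝ) : ℂ)‖ ≤ 1 / (lam * y ^ 2 * (y ^ 2) ^ lam) := by
    intro t
    rw [Complex.norm_real, Real.norm_of_nonneg (reducedKernel_nonneg hy)]
    exact reducedKernel_le_const hlam hy
  have h1 := Integrable.bdd_mul h0 hkm (Filter.Eventually.of_forall hkb)
  have e : (fun t => f t * (((x - t) * reducedKernel lam y x t : ℝ) : ℂ)) =
      fun t => ((reducedKernel lam y x t : ℝ) : ℂ) * (((x - t : ℝ) : ℂ) * f t) := by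
    ext t
    rw [Complex.ofReal_mul]
    ring
  rw [e]
  exact h1

/-- Fubini puts the `t` integral inside, so that cancellation can be used separately for each `u`.
-/
theorem reducedIntegral_eq_integral_integral {lam y x c d B : ℝ} (hlam : 0 < lam) (hy : 0 < y)
    {f : ℝ → ℂ} (hf : Measurable f) (hB : ∀ t, ‖f t‖ ≤ B) (hs : ∀ t ∉ Metric.ball c d, f t = 0) :
    reducedIntegral lam y f x = ∫ u in Set.Ioo (0 : ℝ) 1,
      ((u ^ (lam - 1) * (1 - u) ^ lam : ℝ) : ℂ) *
        ∫ t, (((x - t) * kernelDen y x t u ^ (-(lam + 1)) : ℝ) : ℂ) * f t := by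
  set F : ℝ → ℝ → ℂ := fun t u => f t * (((x - t) * (u ^ (lam - 1) * (1 - u) ^ lam *
    kernelDen y x t u ^ (-(lam + 1))) : ℝ) : ℂ) with hF
  have h0 := integrable_mul_of_support (g := fun t => ((x - t : ℝ) : ℂ)) hf (by fun_prop) hB hs
  have hdom : Integrable (fun z : ℝ × ℝ => ‖((x - z.1 : ℝ) : ℂ) * f z.1‖ *
      (z.2 ^ (lam - 1) * (y ^ 2) ^ (-(lam + 1))))
      (volume.prod (volume.restrict (Set.Ioo (0 : ℝ) 1))) :=
    h0.norm.mul_prod ((integrableOn_rpow_sub_one hlam).mul_const _)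
  have hFm : Measurable (Function.uncurry F) := by
    refine (hf.comp measurable_fst).mul (Complex.measurable_ofReal.comp ?_)
    unfold kernelDen; fun_prop
  have hFi : Integrable (Function.uncurry F)
      (volume.prod (volume.restrict (Set.Ioo (0 : ℝ) 1))) := by
    refine hdom.mono' hFm.aestronglyMeasurable ?_
    have hmem : ∀ᵐ z : ℝ × ℝ ∂(volume.prod (volume.restrict (Set.Ioo (0 : ℝ) 1))),
        z.2 ∈ Set.Ioo (0 : ℝ) 1 :=
      Measure.quasiMeasurePreserving_snd.ae (ae_restrict_mem measurableSet_Ioo)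
    filter_upwards [hmem] with z hz
    have h1 := hz.1
    have h2 : 0 < 1 - z.2 := by linarith [hz.2]
    have hG := kernelDen_pos (x := x) (t := z.1) hy hz
    have hle : y ^ 2 ≤ kernelDen y x z.1 z.2 := by
      unfold kernelDen
      nlinarith [mul_nonneg h2.le (sq_nonneg (x - z.1)), mul_nonneg h1.le (sq_nonneg (x + z.1))]
    have h3 := Real.rpow_le_rpow_of_nonpos (by positivity) hle (by linarith : -(lam + 1) ≤ 0)
    have h4 : (1 - z.2) ^ lam ≤ 1 := Real.rpow_le_one h2.le (by linarith) hlam.le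
    simp only [Function.uncurry, hF, norm_mul, Complex.norm_real]
    rw [Real.norm_of_nonneg (Real.rpow_pos_of_pos h1 _).le,
      Real.norm_of_nonneg (Real.rpow_pos_of_pos h2 _).le,
      Real.norm_of_nonneg (Real.rpow_pos_of_pos hG _).le]
    calc _ = ‖x - z.1‖ * ‖f z.1‖ * (z.2 ^ (lam - 1) * (1 - z.2) ^ lam *
          kernelDen y x z.1 z.2 ^ (-(lam + 1))) := by ring
      _ ≤ ‖x - z.1‖ * ‖f z.1‖ * (z.2 ^ (lam - 1) * 1 * (y ^ 2) ^ (-(lam + 1))) := by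
        have := Real.rpow_pos_of_pos h1 (lam - 1)
        have := Real.rpow_pos_of_pos h2 lam
        have := Real.rpow_pos_of_pos hG (-(lam + 1))
        gcongr
      _ = _ := by ring
  have hL : reducedIntegral lam y f x = ∫ t, ∫ u in Set.Ioo (0 : ℝ) 1, F t u := by
    unfold reducedIntegral
    congr 1; ext t
    rw [hF, reducedKernel, integral_const_mul, integral_complex_ofReal, integral_const_mul]
  rw [hL, integral_integral_swap hFi]
  congr 1; ext u
  rw [← integral_const_mul]
  congr 1; ext t
  simp only [hF]; push_cast; ring

/-- For each `u` a polynomial depending on `u` is subtracted at no cost. The relative error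
integrates back to the kernel at `t = 1`. The approximation gives `(d/r)^(N+1)`; the last `d/r`
comes from the support length `2d` and the kernel size `1/r`. -/
theorem exists_norm_reducedIntegral_far_le {lam : ℝ} (hlam : 0 < lam) (N : ℕ) :
    ∃ C : ℝ, 0 < C ∧ ∀ (y x d B : ℝ) (f : ℝ → ℂ), 0 < y → 0 < d → x ≠ 0 → 0 < B →
      Measurable f → (∀ t, ‖f t‖ ≤ B) → (∀ t ∉ Metric.ball 1 d, f t = 0) →
      (∀ k ≤ 2 * N, ∫ t : ℝ, (t : ℂ) ^ k * f t = 0) → 3 / 2 * d ≤ |(|x| - 1)| →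
      ‖reducedIntegral lam y f x‖ ≤
        C * B * ((d / |(|x| - 1)|) ^ (N + 2) * (|x| + 1) ^ (-(2 * lam))) := by
  obtain ⟨C1, hC1, h1⟩ := exists_polynomial_kernel_approx (-(lam + 1)) N
  obtain ⟨C2, hC2, h2⟩ := exists_reducedKernel_one_le hlam
  refine ⟨2 * C1 * C2, by positivity, fun y x d B f hy hd hx hB hf hfB hs hmom hr => ?_⟩
  set r := |(|x| - 1)| with hrdef
  have hr0 : 0 < r := by linarith
  have hx1 : |x| ≠ 1 := fun h => by rw [hrdef, h] at hr0; simp at hr0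
  have hinner : ∀ u ∈ Set.Ioo (0 : ℝ) 1,
      ‖∫ t, (((x - t) * kernelDen y x t u ^ (-(lam + 1)) : ℝ) : ℂ) * f t‖ ≤
      C1 * (d / r) ^ (N + 1) * (|x - 1| * kernelDen y x 1 u ^ (-(lam + 1))) * B * (2 * d) := by
    intro u hu
    obtain ⟨P, hP, hPb⟩ := h1 y x u d hy hu hd hr
    have hPi := integral_polynomial_mul_eq_zero (f := f) (n := 2 * N)
      (fun k => integrable_mul_of_support hf (by fun_prop) hfB hs) hmom hP
    have hcont : Continuous fun t : ℝ => (((x - t) * kernelDen y x t u ^ (-(lam + 1)) : ℝ) : ℂ) := by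
      refine Complex.continuous_ofReal.comp ((continuous_const.sub continuous_id).mul ?_)
      refine Continuous.rpow_const ?_ fun t => Or.inl (kernelDen_pos hy hu).ne'
      unfold kernelDen; fun_prop
    have hi := integrable_mul_of_support hf hcont hfB hs
    have e : ∫ t, (((x - t) * kernelDen y x t u ^ (-(lam + 1)) : ℝ) : ℂ) * f t =
        ∫ t, (((x - t) * kernelDen y x t u ^ (-(lam + 1)) - P.eval t : ℝ) : ℂ) * f t := by
      rw [← sub_zero (∫ t, (((x - t) * kernelDen y x t u ^ (-(lam + 1)) : ℝ) : ℂ) * f t),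
        ← hPi.2, ← integral_sub hi hPi.1]
      congr 1; ext t; push_cast; ring
    rw [e]
    refine norm_integral_le_of_support (c := 1) hd (fun t ht => ?_) fun t ht => by simp [hs t ht]
    rw [norm_mul, Complex.norm_real]
    have h3 := hPb t (by simpa [Real.dist_eq] using ht)
    exact mul_le_mul h3 (hfB t) (norm_nonneg _) ((abs_nonneg _).trans h3)
  rw [reducedIntegral_eq_integral_integral hlam hy hf hfB hs]
  have hK := h2 y x hy hx hx1
  have hInt : IntegrableOn (fun u : ℝ => u ^ (lam - 1) * (1 - u) ^ lam *
      kernelDen y x 1 u ^ (-(lam + 1))) (Set.Ioo 0 1) := by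
    have hD : 0 < y ^ 2 + (x - 1) ^ 2 := by positivity
    have hE : 0 < y ^ 2 + (x + 1) ^ 2 := by positivity
    refine Integrable.mono' (integrableOn_rpow_mul_affine hlam hD hE (-(lam + 1)))
      (Measurable.aestronglyMeasurable (by unfold kernelDen; fun_prop)) ?_
    filter_upwards [ae_restrict_mem measurableSet_Ioo] with u hu
    have h1 := hu.1
    have h2 : 0 < 1 - u := by linarith [hu.2]
    have h3 : (1 - u) ^ lam ≤ 1 := Real.rpow_le_one h2.le (by linarith) hlam.le
    have hG := kernelDen_pos (x := x) (t := 1) hy hu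
    rw [Real.norm_of_nonneg (by positivity), ← kernelDen_eq_affine]
    calc _ ≤ u ^ (lam - 1) * 1 * _ := by gcongr
      _ = _ := by rw [mul_one]
  have hbound : ‖∫ u in Set.Ioo (0 : ℝ) 1, ((u ^ (lam - 1) * (1 - u) ^ lam : ℝ) : ℂ) *
      ∫ t, (((x - t) * kernelDen y x t u ^ (-(lam + 1)) : ℝ) : ℂ) * f t‖ ≤
      ∫ u in Set.Ioo (0 : ℝ) 1, C1 * (d / r) ^ (N + 1) * |x - 1| * B * (2 * d) *
        (u ^ (lam - 1) * (1 - u) ^ lam * kernelDen y x 1 u ^ (-(lam + 1))) := by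
    refine norm_integral_le_of_norm_le (hInt.const_mul _) ?_
    filter_upwards [ae_restrict_mem measurableSet_Ioo] with u hu
    have h1 := hu.1
    have h2 : 0 < 1 - u := by linarith [hu.2]
    rw [norm_mul, Complex.norm_real, Real.norm_of_nonneg (by positivity)]
    calc _ ≤ u ^ (lam - 1) * (1 - u) ^ lam * _ :=
          mul_le_mul_of_nonneg_left (hinner u hu) (by positivity)
      _ = _ := by ring
  refine hbound.trans ?_
  rw [integral_const_mul]
  calc _ = C1 * (d / r) ^ (N + 1) * B * (2 * d) * (|x - 1| * reducedKernel lam y x 1) := by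
        rw [reducedKernel]; ring
    _ ≤ C1 * (d / r) ^ (N + 1) * B * (2 * d) * (C2 * ((|x| + 1) ^ (-(2 * lam)) * r⁻¹)) := by
        gcongr
    _ = _ := by rw [pow_succ (d / r) (N + 1)]; ring

/-- No moments are needed: for `t` in the support `x + t` stays in `(-2, 2)`, where `|s|^(-1/2)` is
integrable. -/
theorem exists_norm_reducedIntegral_mirror_le {lam : ℝ} (hlam : 0 < lam) :
    ∃ C : ℝ, 0 < C ∧ ∀ (y x d B : ℝ) (f : ℝ → ℂ), 0 < y → 0 < d → d < 1 / 2 → x < 0 → 0 < B →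
      (∀ t, ‖f t‖ ≤ B) → (∀ t ∉ Metric.ball 1 d, f t = 0) → |x + 1| < 3 / 2 * d →
      ‖reducedIntegral lam y f x‖ ≤ C * B := by
  obtain ⟨C1, hC1, h1⟩ := exists_reducedKernel_neg_le hlam
  have hint : IntegrableOn (fun s : ℝ => |s| ^ (-(1 / 2) : ℝ)) (Set.Ioo (-2) 2) := by
    have hp : IntegrableOn (fun s : ℝ => |s| ^ (-(1 / 2) : ℝ)) (Set.Ioc 0 2) := by
      have := intervalIntegral.intervalIntegrable_rpow' (a := 0) (b := 2)
        (by norm_num : (-1 : ℝ) < -(1 / 2))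
      rw [intervalIntegrable_iff_integrableOn_Ioc_of_le zero_le_two] at this
      refine this.congr_fun (fun s hs => ?_) measurableSet_Ioc
      simp only [abs_of_pos hs.1]
    have hp' : IntervalIntegrable (fun s : ℝ => |s| ^ (-(1 / 2) : ℝ)) volume 0 2 := by
      rwa [intervalIntegrable_iff_integrableOn_Ioc_of_le zero_le_two]
    have hn : IntervalIntegrable (fun s : ℝ => |s| ^ (-(1 / 2) : ℝ)) volume (-2) 0 := by
      have := (IntervalIntegrable.iff_comp_neg).1 hp'
      simpa using this.symm
    have := hn.trans hp'
    rwa [intervalIntegrable_iff_integrableOn_Ioo_of_le (by norm_num)] at this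
  set I := ∫ s in Set.Ioo (-2 : ℝ) 2, |s| ^ (-(1 / 2) : ℝ) with hI
  have hI0 : 0 ≤ I := setIntegral_nonneg measurableSet_Ioo fun s _ => by positivity
  refine ⟨C1 * (I + 1), by positivity, fun y x d B f hy hd hd2 hx hB hfB hs hxd => ?_⟩
  have hg : Integrable ((Set.Ioo (-2 : ℝ) 2).indicator fun s : ℝ => |s| ^ (-(1 / 2) : ℝ)) :=
    hint.integrable_indicator measurableSet_Ioo
  have hle : ‖reducedIntegral lam y f x‖ ≤ ∫ t, B * C1 *
      ((Set.Ioo (-2 : ℝ) 2).indicator (fun s : ℝ => |s| ^ (-(1 / 2) : ℝ)) (t + x)) := by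
    refine norm_integral_le_of_norm_le ((hg.comp_add_right x).const_mul _) ?_
    filter_upwards [compl_mem_ae_iff.2 (measure_singleton (μ := (volume : Measure ℝ)) (-x))]
      with t ht
    have hne : x + t ≠ 0 := fun h => ht (by rw [Set.mem_singleton_iff]; linarith)
    by_cases htb : t ∈ Metric.ball 1 d
    · have htd : |t - 1| < d := by simpa [Real.dist_eq] using htb
      have ht1 := abs_lt.1 htd
      have hx1 := abs_lt.1 hxd
      have hk := h1 y x t hy hx (by linarith) hne
      rw [Set.indicator_of_mem (show t + x ∈ Set.Ioo (-2 : ℝ) 2 from ⟨by linarith, by linarith⟩), norm_mul, Complex.norm_real,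
        Real.norm_eq_abs, abs_mul, abs_of_nonneg (reducedKernel_nonneg hy), add_comm t x]
      calc _ ≤ B * (C1 * |x + t| ^ (-(1 / 2) : ℝ)) :=
            mul_le_mul (hfB t) hk (mul_nonneg (abs_nonneg _) (reducedKernel_nonneg hy)) hB.le
        _ = _ := by ring
    · rw [hs t htb, zero_mul, norm_zero]
      refine mul_nonneg (by positivity) (Set.indicator_nonneg (fun s _ => by positivity) _)
  refine hle.trans ?_
  rw [integral_const_mul, integral_add_right_eq_self
    ((Set.Ioo (-2 : ℝ) 2).indicator fun s : ℝ => |s| ^ (-(1 / 2) : ℝ)),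
    integral_indicator measurableSet_Ioo]
  calc _ = C1 * I * B := by rw [hI]; ring
    _ ≤ _ := by gcongr; linarith

theorem exists_norm_reducedIntegral_near_le {lam : ℝ} (hlam : 0 < lam) :
    ∃ C : ℝ, 0 < C ∧ ∀ (y x d B : ℝ) (f : ℝ → ℂ), 0 < y → 0 < d → d < 1 / 2 → 0 < B →
      Measurable f → (∀ t, ‖f t‖ ≤ B) → (∀ t ∉ Metric.ball 1 d, f t = 0) → |x - 1| < 3 / 2 * d →
      ‖reducedIntegral lam y f x‖ ≤ C * B + 1 / lam * ‖∫ t, ((hilbertKernel y (x - t) : ℝ) : ℂ) *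
        ((((y ^ 2 + (2 * t) ^ 2) ^ (-lam) : ℝ) : ℂ) * f t)‖ := by
  obtain ⟨C1, hC1, h1⟩ := exists_abs_reducedKernel_sub_le hlam
  refine ⟨C1, hC1, fun y x d B f hy hd hd2 hB hf hfB hs hxd => ?_⟩
  have hx1 := abs_lt.1 hxd
  have hc1 : Continuous fun t : ℝ => ((hilbertKernel y (x - t) : ℝ) : ℂ) *
      (((y ^ 2 + (2 * t) ^ 2) ^ (-lam) : ℝ) : ℂ) := by
    refine (Complex.continuous_ofReal.comp ((continuous_hilbertKernel hy).comp (by fun_prop))).mul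
      (Complex.continuous_ofReal.comp ?_)
    exact Continuous.rpow_const (by fun_prop) fun t => Or.inl (by positivity)
  have hi1 := integrable_mul_of_support hf hc1 hfB hs
  have hi2 := integrable_reducedIntegral (x := x) hlam hy hf hfB hs
  have e : reducedIntegral lam y f x = (∫ t, (f t * (((x - t) * reducedKernel lam y x t : ℝ) : ℂ) -
      (1 / lam : ℝ) * (((hilbertKernel y (x - t) : ℝ) : ℂ) *
        (((y ^ 2 + (2 * t) ^ 2) ^ (-lam) : ℝ) : ℂ) * f t))) +
      (1 / lam : ℝ) * ∫ t, ((hilbertKernel y (x - t) : ℝ) : ℂ) *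
        ((((y ^ 2 + (2 * t) ^ 2) ^ (-lam) : ℝ) : ℂ) * f t) := by
    rw [integral_sub hi2 (hi1.const_mul _), integral_const_mul, reducedIntegral]
    simp only [mul_assoc]
    ring
  rw [e]
  refine (norm_add_le _ _).trans (add_le_add ?_ ?_)
  · refine (norm_integral_le_of_support (c := 1) hd (B := C1 * B) (fun t ht => ?_)
      fun t ht => by simp [hs t ht]).trans ?_
    · have htd : |t - 1| < d := by simpa [Real.dist_eq] using ht
      have ht1 := abs_lt.1 htd
      have hk := h1 y x t hy (by linarith) (by linarith)
      have : f t * (((x - t) * reducedKernel lam y x t : ℝ) : ℂ) -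
          (1 / lam : ℝ) * (((hilbertKernel y (x - t) : ℝ) : ℂ) *
          (((y ^ 2 + (2 * t) ^ 2) ^ (-lam) : ℝ) : ℂ) * f t) =
          (((x - t) * reducedKernel lam y x t -
        (x - t) / (y ^ 2 + (x - t) ^ 2) * ((y ^ 2 + (2 * t) ^ 2) ^ (-lam) / lam) : ℝ) : ℂ) *
          f t := by
        rw [hilbertKernel]; push_cast; ring
      rw [this, norm_mul, Complex.norm_real]
      exact mul_le_mul hk (hfB t) (norm_nonneg _) hC1.le
    · have : 0 < C1 * B := by positivity
      nlinarith
  · rw [norm_mul, Complex.norm_real, Real.norm_of_nonneg (by positivity)]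

/-! ### From pointwise bounds to the integral of the `p`-th power. -/

theorem rpow_le_one_add_sq {s p : ℝ} (hs : 0 ≤ s) (hp : 0 ≤ p) (hp2 : p ≤ 2) :
    s ^ p ≤ 1 + s ^ 2 := by
  rcases le_total s 1 with h | h
  · have := Real.rpow_le_one hs h hp
    nlinarith [sq_nonneg s]
  · have := Real.rpow_le_rpow_of_exponent_le h hp2
    rw [Real.rpow_two] at this
    linarith

/-- To be read with `q = r/d`, `X = |x|`, `R = |x| + 1`. The weight leaves `R^(2λ(1-p))`, paid for
by `R ≤ 2q`; the factor `3/5` reflects `q ≥ (3/5)(1 + q)` for `q ≥ 3/2`. -/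
theorem far_power_bound {C B q R X S p lam : ℝ} {n : ℕ} (hlam : 0 < lam) (hp : 0 < p)
    (hp1 : p ≤ 1) (hC : 0 < C) (hB : 0 < B) (hq : 3 / 2 ≤ q) (hX : 0 ≤ X) (hXR : X ≤ R)
    (hRq : R ≤ 2 * q) (hR : 0 < R) (hS : 0 ≤ S)
    (h : S ≤ C * B * (q⁻¹ ^ n * R ^ (-(2 * lam))))
    (hg : 0 ≤ n * p - 2 * lam * (1 - p)) :
    S ^ p * X ^ (2 * lam) ≤ C ^ p * 2 ^ (2 * lam * (1 - p)) *
      (3 / 5) ^ (-(n * p - 2 * lam * (1 - p))) * B ^ p *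
      (1 + q) ^ (-(n * p - 2 * lam * (1 - p))) := by
  have hq0 : 0 < q := by linarith
  have hβ : 0 ≤ 2 * lam * (1 - p) := by
    have : 0 ≤ 1 - p := by linarith
    positivity
  have e1 : (q⁻¹ ^ n) ^ p = q ^ (-(n * p)) := by
    rw [← Real.rpow_natCast, ← Real.rpow_mul (by positivity), Real.inv_rpow hq0.le,
      Real.rpow_neg hq0.le]
  have e2 : (R ^ (-(2 * lam))) ^ p * R ^ (2 * lam) = R ^ (2 * lam * (1 - p)) := by
    rw [← Real.rpow_mul hR.le, ← Real.rpow_add hR]; congr 1; ring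
  have e3 : q ^ (-(n * p - 2 * lam * (1 - p))) ≤
      (3 / 5) ^ (-(n * p - 2 * lam * (1 - p))) * (1 + q) ^ (-(n * p - 2 * lam * (1 - p))) := by
    rw [← Real.mul_rpow (by norm_num) (by positivity)]
    exact Real.rpow_le_rpow_of_nonpos (by positivity) (by linarith) (by linarith)
  calc S ^ p * X ^ (2 * lam) ≤ (C * B * (q⁻¹ ^ n * R ^ (-(2 * lam)))) ^ p * R ^ (2 * lam) := by
        gcongr
    _ = C ^ p * B ^ p * (q ^ (-(n * p)) * R ^ (2 * lam * (1 - p))) := by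
        rw [Real.mul_rpow (by positivity) (by positivity), Real.mul_rpow hC.le hB.le,
          Real.mul_rpow (by positivity) (by positivity), e1, ← e2]
        ring
    _ ≤ C ^ p * B ^ p * (q ^ (-(n * p)) * (2 * q) ^ (2 * lam * (1 - p))) := by gcongr
    _ = C ^ p * B ^ p * 2 ^ (2 * lam * (1 - p)) * q ^ (-(n * p - 2 * lam * (1 - p))) := by
        rw [Real.mul_rpow zero_le_two hq0.le]
        have : q ^ (-(n * p - 2 * lam * (1 - p))) =
            q ^ (-(n * p)) * q ^ (2 * lam * (1 - p)) := by
          rw [← Real.rpow_add hq0]; congr 1; ring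
        rw [this]; ring
    _ ≤ C ^ p * B ^ p * 2 ^ (2 * lam * (1 - p)) * ((3 / 5) ^ (-(n * p - 2 * lam * (1 - p))) *
        (1 + q) ^ (-(n * p - 2 * lam * (1 - p)))) := by gcongr
    _ = _ := by ring

/-- Near the support the decaying majorant `Φ` is at least `1/c`, so additive constants are absorbed
into it; `h` is the term left to the `L²` bound. -/
theorem near_power_bound {T b q w W c Φ h L C : ℝ} (hT : T ≤ b * (1 + q))
    (hq : q ≤ 2 * C ^ 2 + L * h) (hc : 1 ≤ c * Φ) (hw : 0 ≤ w) (hwW : w ≤ W) (hb : 0 ≤ b)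
    (hq0 : 0 ≤ q) (hL : 0 ≤ L) (hh : 0 ≤ h) (hc0 : 0 ≤ c) (hΦ : 0 ≤ Φ) :
    T * w ≤ W * ((1 + 2 * C ^ 2) * c + L) * b * (Φ + h) := by
  have h1 : 1 + q ≤ ((1 + 2 * C ^ 2) * c + L) * (Φ + h) := by
    have h2 : 1 + 2 * C ^ 2 ≤ (1 + 2 * C ^ 2) * (c * Φ) :=
      le_mul_of_one_le_right (by positivity) hc
    have h3 : 0 ≤ (1 + 2 * C ^ 2) * c * h + L * Φ := by positivity
    linarith
  calc T * w ≤ b * (1 + q) * w := by gcongr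
    _ ≤ b * (1 + q) * W := by gcongr
    _ ≤ b * (((1 + 2 * C ^ 2) * c + L) * (Φ + h)) * W := by
      have := hw.trans hwW
      gcongr
    _ = _ := by ring

/-- Pointwise bound of the operator on functions with vanishing moments. -/
theorem exists_pointwise_bound {lam p : ℝ} (hlam : 0 < lam) (hp : 0 < p) (hp1 : p ≤ 1) {N : ℕ}
    (hN : 1 < (N + 2 : ℕ) * p - 2 * lam * (1 - p)) :
    ∃ K : ℝ, 0 < K ∧ ∀ (y x d B : ℝ) (f : ℝ → ℂ), 0 < y → 0 < d → d < 1 / 2 → x ≠ 0 → 0 < B →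
      Measurable f → (∀ t, ‖f t‖ ≤ B) → (∀ t ∉ Metric.ball 1 d, f t = 0) →
      (∀ k ≤ 2 * N, ∫ t : ℝ, (t : ℂ) ^ k * f t = 0) →
      ‖reducedIntegral lam y f x‖ ^ p * |x| ^ (2 * lam) ≤ K * B ^ p *
        ((1 + |(|x| - 1)| / d) ^ (-((N + 2 : ℕ) * p - 2 * lam * (1 - p))) +
          ‖∫ t, ((hilbertKernel y (x - t) : ℝ) : ℂ) *
            ((((y ^ 2 + (2 * t) ^ 2) ^ (-lam) : ℝ) : ℂ) * f t)‖ ^ 2 / B ^ 2) := by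
  set γ : ℝ := (N + 2 : ℕ) * p - 2 * lam * (1 - p) with hγ
  obtain ⟨C1, hC1, h1⟩ := exists_norm_reducedIntegral_far_le hlam N
  obtain ⟨C2, hC2, h2⟩ := exists_norm_reducedIntegral_mirror_le hlam
  obtain ⟨C3, hC3, h3⟩ := exists_norm_reducedIntegral_near_le hlam
  set Ka : ℝ := C1 ^ p * 2 ^ (2 * lam * (1 - p)) * (3 / 5) ^ (-γ) with hKa
  set Kb : ℝ := C2 ^ p * (7 / 4) ^ (2 * lam) * (5 / 2) ^ γ with hKb
  set Kc : ℝ := (7 / 4) ^ (2 * lam) * ((1 + 2 * C3 ^ 2) * (5 / 2) ^ γ + 2 / lam ^ 2) with hKc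
  have pKa : 0 < Ka := by positivity
  have pKb : 0 < Kb := by positivity
  have pKc : 0 < Kc := by positivity
  refine ⟨Ka + Kb + Kc, by positivity, fun y x d B f hy hd hd2 hx hB hf hfB hs hmom => ?_⟩
  set r := |(|x| - 1)| with hr
  set H := ‖∫ t, ((hilbertKernel y (x - t) : ℝ) : ℂ) *
            ((((y ^ 2 + (2 * t) ^ 2) ^ (-lam) : ℝ) : ℂ) * f t)‖ with hH
  have hr0 : 0 ≤ r := abs_nonneg _
  have hBp : 0 < B ^ p := by positivity
  have hΦ : 0 < (1 + r / d) ^ (-γ) := by positivity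
  have hM : 0 ≤ H ^ 2 / B ^ 2 := by positivity
  rcases le_or_gt (3 / 2 * d) r with hfar | hnear
  · have hb := h1 y x d B f hy hd hx hB hf hfB hs hmom hfar
    have hrd : 3 / 2 ≤ r / d := by rwa [le_div_iff₀ hd]
    have hxr : |x| ≤ 1 + r := by linarith [le_abs_self (|x| - 1)]
    have hrr : r ≤ 1 / 2 * (r / d) := by
      rw [← mul_div_assoc, le_div_iff₀ hd]; nlinarith
    rw [← hr, ← inv_div r d] at hb
    have := far_power_bound hlam hp hp1 hC1 hB hrd (abs_nonneg x) (by linarith : |x| ≤ |x| + 1)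
      (by linarith) (by positivity) (norm_nonneg _) hb (by rw [← hγ]; linarith)
    rw [← hγ, ← hKa] at this
    refine this.trans ?_
    have h4 : Ka * B ^ p * (1 + r / d) ^ (-γ) ≤ (Ka + Kb + Kc) * B ^ p * (1 + r / d) ^ (-γ) := by
      gcongr; linarith
    refine h4.trans ?_
    gcongr
    linarith
  -- Here `r < 3d/2 < 3/4`; likewise `5/2` below is `1 + 3/2`, the largest value of `1 + r/d`.
  · have hx7 : |x| ≤ 7 / 4 := by linarith [le_abs_self (|x| - 1)]
    have hxl : |x| ^ (2 * lam) ≤ (7 / 4) ^ (2 * lam) := by gcongr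
    have hone : 1 ≤ (5 / 2) ^ γ * (1 + r / d) ^ (-γ) := by
      have h5 : 1 + r / d ≤ 5 / 2 := by
        have : r / d ≤ 3 / 2 := by rw [div_le_iff₀ hd]; exact hnear.le
        linarith
      have h6 := Real.rpow_le_rpow_of_nonpos (by positivity) h5 (by linarith : -γ ≤ 0)
      calc (1 : ℝ) = (5 / 2) ^ γ * (5 / 2) ^ (-γ) := by
            rw [← Real.rpow_add (by norm_num)]; simp
        _ ≤ _ := by gcongr
    rcases lt_or_gt_of_ne hx with hxn | hxp
    · have hb := h2 y x d B f hy hd hd2 hxn hB hfB hs (by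
        rw [hr, abs_of_neg hxn, abs_sub_comm] at hnear
        rwa [show x + 1 = 1 - -x by ring])
      calc _ ≤ (C2 * B) ^ p * (7 / 4) ^ (2 * lam) := by gcongr
        _ = C2 ^ p * (7 / 4) ^ (2 * lam) * B ^ p * 1 := by rw [Real.mul_rpow hC2.le hB.le]; ring
        _ ≤ C2 ^ p * (7 / 4) ^ (2 * lam) * B ^ p * ((5 / 2) ^ γ * (1 + r / d) ^ (-γ)) := by gcongr
        _ = Kb * B ^ p * (1 + r / d) ^ (-γ) := by rw [hKb]; ring
        _ ≤ _ := by gcongr <;> linarith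
    · have hb := h3 y x d B f hy hd hd2 hB hf hfB hs (by
        rwa [hr, abs_of_pos hxp] at hnear)
      rw [← hH] at hb
      set S := ‖reducedIntegral lam y f x‖ with hS
      have hS0 : 0 ≤ S := norm_nonneg _
      have hSB : S / B ≤ C3 + 1 / lam * (H / B) := by
        rw [div_le_iff₀ hB]
        refine hb.trans (le_of_eq ?_)
        field_simp
      have hSB2 : (S / B) ^ 2 ≤ 2 * C3 ^ 2 + 2 / lam ^ 2 * (H ^ 2 / B ^ 2) := by
        have h7 : (S / B) ^ 2 ≤ (C3 + 1 / lam * (H / B)) ^ 2 := by gcongr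
        have h8 : 2 / lam ^ 2 * (H ^ 2 / B ^ 2) = 2 * (1 / lam * (H / B)) ^ 2 := by field_simp
        rw [h8]
        nlinarith [sq_nonneg (C3 - 1 / lam * (H / B))]
      have hSp : S ^ p ≤ B ^ p * (1 + (S / B) ^ 2) := by
        have h9 := rpow_le_one_add_sq (s := S / B) (by positivity) hp.le (by linarith)
        rw [Real.div_rpow hS0 hB.le, div_le_iff₀ hBp] at h9
        linarith
      have := near_power_bound hSp hSB2 hone (by positivity) hxl hBp.le (by positivity)
        (by positivity) hM (by positivity) hΦ.le
      rw [← hKc] at this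
      refine this.trans ?_
      gcongr
      linarith

/-- Uniform bound for functions with vanishing moments supported near `1`. -/
theorem exists_integral_reducedIntegral_le {lam p : ℝ} (hlam : 0 < lam) (hp : 0 < p) (hp1 : p ≤ 1)
    {N : ℕ} (hN : 1 < (N + 2 : ℕ) * p - 2 * lam * (1 - p)) :
    ∃ K : ℝ, 0 < K ∧ ∀ (y d B : ℝ) (f : ℝ → ℂ), 0 < y → 0 < d → d < 1 / 2 → 0 < B →
      Measurable f → (∀ t, ‖f t‖ ≤ B) → (∀ t ∉ Metric.ball 1 d, f t = 0) →
      (∀ k ≤ 2 * N, ∫ t : ℝ, (t : ℂ) ^ k * f t = 0) →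
      Integrable (fun x => ‖reducedIntegral lam y f x‖ ^ p * |x| ^ (2 * lam)) ∧
        ∫ x, ‖reducedIntegral lam y f x‖ ^ p * |x| ^ (2 * lam) ≤ K * B ^ p * d := by
  obtain ⟨K, hK, hpt⟩ := exists_pointwise_bound hlam hp hp1 hN
  set γ : ℝ := (N + 2 : ℕ) * p - 2 * lam * (1 - p) with hγ
  set φ : ℝ → ℝ := fun s => (1 + ‖s‖) ^ (-γ) with hφ
  have hφi : Integrable φ := integrable_one_add_norm (by simpa using hN)
  have hφ0 : ∀ s, 0 ≤ φ s := fun s => by positivity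
  refine ⟨K * (2 * (∫ s, φ s) + 2 * Real.pi ^ 2), ?_,
    fun y d B f hy hd hd2 hB hf hfB hs hmom => ?_⟩
  · have : 0 ≤ ∫ s, φ s := integral_nonneg hφ0
    positivity
  set g : ℝ → ℂ := fun t => (((y ^ 2 + (2 * t) ^ 2) ^ (-lam) : ℝ) : ℂ) * f t with hg
  have hgm : Measurable g := by
    refine (Complex.measurable_ofReal.comp ?_).mul hf
    fun_prop
  have hgs : ∀ t ∉ Metric.ball 1 d, g t = 0 := fun t ht => by simp [hg, hs t ht]
  -- On the support `2t ≥ 1`, so the frozen factor is at most `1` whatever `y` is.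
  have hgB : ∀ t, ‖g t‖ ≤ B := fun t => by
    by_cases ht : t ∈ Metric.ball 1 d
    · have ht1 := abs_lt.1 (show |t - 1| < d by simpa [Real.dist_eq] using ht)
      have h1 : 1 ≤ y ^ 2 + (2 * t) ^ 2 := by nlinarith [sq_nonneg y]
      have h2 : (y ^ 2 + (2 * t) ^ 2) ^ (-lam) ≤ 1 :=
        Real.rpow_le_one_of_one_le_of_nonpos h1 (by linarith)
      rw [hg, norm_mul, Complex.norm_real, Real.norm_of_nonneg (by positivity)]
      calc _ ≤ 1 * B := by gcongr; exact hfB t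
        _ = B := one_mul B
    · rw [hgs t ht, norm_zero]; exact hB.le
  have hgi : Integrable g :=
    integrable_of_bounded_of_support hgm.aestronglyMeasurable (fun t _ => hgB t) hgs
  have hgn : ∫ t, ‖g t‖ ≤ B * (2 * d) := by
    have := norm_integral_le_of_support (f := fun t => ((‖g t‖ : ℝ) : ℂ)) (c := 1) (B := B) hd
      (fun t _ => by rw [Complex.norm_real, norm_norm]; exact hgB t)
      fun t ht => by simp [hgs t ht]
    rwa [integral_complex_ofReal, Complex.norm_real,
      Real.norm_of_nonneg (integral_nonneg fun t => norm_nonneg _)] at this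
  obtain ⟨hHi, hHle⟩ := integral_norm_sq_hilbert_le hy hgm hgB hgi
  have hdne : d ≠ 0 := hd.ne'
  have hi1 : Integrable fun x => φ ((x - 1) / d) := (hφi.comp_div hdne).comp_sub_right 1
  have hi2 : Integrable fun x => φ ((x + 1) / d) := (hφi.comp_div hdne).comp_add_right 1
  have hv1 : ∫ x, φ ((x - 1) / d) = d * ∫ s, φ s := by
    rw [integral_sub_right_eq_self (fun x => φ (x / d)) 1, Measure.integral_comp_div,
      abs_of_pos hd, smul_eq_mul]
  have hv2 : ∫ x, φ ((x + 1) / d) = d * ∫ s, φ s := by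
    rw [integral_add_right_eq_self (fun x => φ (x / d)) 1, Measure.integral_comp_div,
      abs_of_pos hd, smul_eq_mul]
  set D : ℝ → ℝ := fun x => K * B ^ p * ((φ ((x - 1) / d) + φ ((x + 1) / d)) +
    ‖∫ t, ((hilbertKernel y (x - t) : ℝ) : ℂ) * g t‖ ^ 2 / B ^ 2) with hD
  have hDi : Integrable D := ((hi1.add hi2).add (hHi.div_const _)).const_mul _
  have hle : ∀ᵐ x : ℝ, ‖reducedIntegral lam y f x‖ ^ p * |x| ^ (2 * lam) ≤ D x := by
    filter_upwards [compl_mem_ae_iff.2 (measure_singleton (μ := (volume : Measure ℝ)) 0)] with x hx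
    refine (hpt y x d B f hy hd hd2 hx hB hf hfB hs hmom).trans ?_
    have hΦ : (1 + |(|x| - 1)| / d) ^ (-γ) ≤ φ ((x - 1) / d) + φ ((x + 1) / d) := by
      have e : ∀ s : ℝ, φ (s / d) = (1 + |s| / d) ^ (-γ) := fun s => by
        simp only [hφ]
        rw [Real.norm_eq_abs, abs_div, abs_of_pos hd]
      rcases abs_cases x with ⟨h, _⟩ | ⟨h, _⟩
      · rw [h, ← e (x - 1)]
        linarith [hφ0 ((x + 1) / d)]
      · rw [h, show |-x - 1| = |x + 1| by rw [← abs_neg]; congr 1; ring, ← e (x + 1)]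
        linarith [hφ0 ((x - 1) / d)]
    rw [hD]
    have : 0 < B ^ p := by positivity
    simp only
    gcongr
  have hmeas : AEStronglyMeasurable
      (fun x => ‖reducedIntegral lam y f x‖ ^ p * |x| ^ (2 * lam)) volume := by
    have := measurable_reducedIntegral lam y hf
    exact ((this.norm.pow_const p).mul (by fun_prop)).aestronglyMeasurable
  have hnn : ∀ x, 0 ≤ ‖reducedIntegral lam y f x‖ ^ p * |x| ^ (2 * lam) := fun x => by positivity
  have hint : Integrable (fun x => ‖reducedIntegral lam y f x‖ ^ p * |x| ^ (2 * lam)) := by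
    refine hDi.mono' hmeas ?_
    filter_upwards [hle] with x hx
    rwa [Real.norm_of_nonneg (hnn x)]
  refine ⟨hint, (integral_mono_ae hint hDi hle).trans ?_⟩
  have hDv : ∫ x, D x = K * B ^ p * ((d * (∫ s, φ s) + d * ∫ s, φ s) +
      (∫ x, ‖∫ t, ((hilbertKernel y (x - t) : ℝ) : ℂ) * g t‖ ^ 2) / B ^ 2) := by
    have hA : Integrable fun x => φ ((x - 1) / d) + φ ((x + 1) / d) := hi1.add hi2
    rw [hD, integral_const_mul, integral_add hA (hHi.div_const _), integral_div,
      integral_add hi1 hi2, hv1, hv2]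
  rw [hDv]
  have hHB : (∫ x, ‖∫ t, ((hilbertKernel y (x - t) : ℝ) : ℂ) * g t‖ ^ 2) / B ^ 2 ≤
      2 * Real.pi ^ 2 * d := by
    rw [div_le_iff₀ (by positivity)]
    refine hHle.trans ?_
    calc _ ≤ Real.pi ^ 2 * B * (B * (2 * d)) := by gcongr
      _ = _ := by ring
  have hBp : 0 < B ^ p := by positivity
  calc _ ≤ K * B ^ p * ((d * (∫ s, φ s) + d * ∫ s, φ s) + 2 * Real.pi ^ 2 * d) := by gcongr
    _ = _ := by ring

/-! ### Dilation to unit scale and normalisation of atoms. -/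

theorem reducedKernel_scale {lam y x t s : ℝ} (hy : 0 < y) (hs : s ≠ 0) :
    reducedKernel lam (|s| * y) (s * x) (s * t) =
      (s ^ 2) ^ (-(lam + 1)) * reducedKernel lam y x t := by
  unfold reducedKernel
  rw [← integral_const_mul]
  refine setIntegral_congr_fun measurableSet_Ioo fun u hu => ?_
  have hG := kernelDen_pos (x := x) (t := t) hy hu
  have e : kernelDen (|s| * y) (s * x) (s * t) u = s ^ 2 * kernelDen y x t u := by
    unfold kernelDen
    rw [mul_pow, sq_abs]
    ring
  rw [e, Real.mul_rpow (by positivity) hG.le]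
  ring

/-- Rescaling of the conjugate Poisson integral to the operator `reducedIntegral`. -/
theorem norm_conjPoissonIntegral_scale {lam y x s : ℝ} (hy : 0 < y) (hs : s ≠ 0) (hx : x ≠ 0)
    (a : ℝ → ℂ) :
    ‖conjPoissonIntegral lam a (|s| * y) (s * x)‖ = |dunklConst lam * reducedConst lam| *
      ‖reducedIntegral lam y (fun t => a (s * t) * ((|t| ^ (2 * lam) : ℝ) : ℂ)) x‖ := by
  have hsp : 0 < |s| := abs_pos.2 hs
  have h1 := Measure.integral_comp_mul_left (fun t => a t *
    ((conjPoissonKernel lam (|s| * y) (s * x) t * |t| ^ (2 * lam) : ℝ) : ℂ)) s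
  have h2 : ∫ t, a (s * t) * ((conjPoissonKernel lam (|s| * y) (s * x) (s * t) *
      |s * t| ^ (2 * lam) : ℝ) : ℂ) =
      ((reducedConst lam * (s * ((s ^ 2) ^ (-(lam + 1)) * |s| ^ (2 * lam))) : ℝ) : ℂ) *
      reducedIntegral lam y (fun t => a (s * t) * ((|t| ^ (2 * lam) : ℝ) : ℂ)) x := by
    rw [reducedIntegral, ← integral_const_mul]
    refine integral_congr_ae ?_
    filter_upwards [compl_mem_ae_iff.2 (measure_singleton (μ := (volume : Measure ℝ)) 0)] with t ht
    have ht0 : t ≠ 0 := ht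
    rw [conjPoissonKernel_eq (by positivity) (mul_ne_zero hs hx) (mul_ne_zero hs ht0),
      reducedKernel_scale hy hs, abs_mul, Real.mul_rpow hsp.le (abs_nonneg t)]
    push_cast
    ring
  rw [h2, abs_inv] at h1
  have h3 : ∫ t, a t * ((conjPoissonKernel lam (|s| * y) (s * x) t * |t| ^ (2 * lam) : ℝ) : ℂ) =
      |s| • (((reducedConst lam * (s * ((s ^ 2) ^ (-(lam + 1)) * |s| ^ (2 * lam))) : ℝ) : ℂ) *
      reducedIntegral lam y (fun t => a (s * t) * ((|t| ^ (2 * lam) : ℝ) : ℂ)) x) := by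
    rw [h1, smul_smul, mul_inv_cancel₀ hsp.ne', one_smul]
  -- The kernel scales by `|s|^(-(2λ+1))` in modulus and the measure `|t|^(2λ) dt` by `|s|^(2λ+1)`,
  -- so nothing remains.
  have h4 : |s| * |s * ((s ^ 2) ^ (-(lam + 1)) * |s| ^ (2 * lam))| = 1 := by
    rw [← sq_abs s, ← Real.rpow_two, ← Real.rpow_mul hsp.le, ← Real.rpow_add hsp, abs_mul,
      abs_of_pos (Real.rpow_pos_of_pos hsp _), ← mul_assoc, ← sq, ← Real.rpow_two,
      ← Real.rpow_add hsp]
    rw [show (2 : ℝ) + (2 * -(lam + 1) + 2 * lam) = 0 by ring, Real.rpow_zero]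
  rw [conjPoissonIntegral, h3, norm_mul, norm_smul, norm_mul, Complex.norm_real, Complex.norm_real,
    Real.norm_eq_abs, Real.norm_eq_abs, Real.norm_eq_abs, abs_abs, abs_mul (reducedConst lam),
    abs_mul (dunklConst lam)]
  calc _ = |dunklConst lam| * |reducedConst lam| *
        (|s| * |s * ((s ^ 2) ^ (-(lam + 1)) * |s| ^ (2 * lam))|) *
        ‖reducedIntegral lam y (fun t => a (s * t) * ((|t| ^ (2 * lam) : ℝ) : ℂ)) x‖ := by ring
    _ = _ := by rw [h4, mul_one]

/-- The ball stays away from the origin: `|x| ≥ |x₀|/2` on it. -/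
theorem dunklVol_ball_ge {lam x₀ δ₀ : ℝ} (hlam : 0 < lam) (hδ : 0 < δ₀) (hδx : δ₀ < |x₀ / 2|) :
    (|x₀| / 2) ^ (2 * lam) * (2 * δ₀) ≤ dunklVol lam (Metric.ball x₀ δ₀) := by
  have hi : IntegrableOn (fun x : ℝ => |x| ^ (2 * lam)) (Metric.ball x₀ δ₀) := by
    have hc : Continuous fun x : ℝ => |x| ^ (2 * lam) :=
      continuous_abs.rpow_const fun x => Or.inr (by positivity)
    exact (hc.continuousOn.integrableOn_compact (isCompact_closedBall x₀ δ₀)).mono_set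
      Metric.ball_subset_closedBall
  have hv : (volume : Measure ℝ).real (Metric.ball x₀ δ₀) = 2 * δ₀ := by
    rw [Measure.real, Real.volume_ball, ENNReal.toReal_ofReal (by linarith)]
  rw [← hv]
  refine setIntegral_ge_of_const_le_real measurableSet_ball measure_ball_lt_top.ne
    (fun x hx => ?_) hi
  have h1 : |x - x₀| < δ₀ := by simpa [Real.dist_eq] using hx
  have h2 : |x₀ / 2| = |x₀| / 2 := by rw [abs_div, abs_of_pos (zero_lt_two' ℝ)]
  have h3 : |x₀| / 2 ≤ |x| := by
    have := abs_sub_abs_le_abs_sub x₀ x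
    rw [abs_sub_comm] at this
    linarith
  gcongr

/-- A bounded representative of an atom. -/
theorem IsDunklAtomOn.exists_representative {lam p A : ℝ} {κ : ℕ} {x₀ δ₀ : ℝ} {a : ℝ → ℂ}
    (h : IsDunklAtomOn lam p A κ x₀ δ₀ a)
    (hB : 0 ≤ A / dunklVol lam (Metric.ball x₀ δ₀) ^ (1 / p)) :
    ∃ b : ℝ → ℂ, Measurable b ∧ a =ᵐ[volume] b ∧
      (∀ t, ‖b t‖ ≤ A / dunklVol lam (Metric.ball x₀ δ₀) ^ (1 / p)) ∧
      ∀ t ∉ Metric.ball x₀ δ₀, b t = 0 := by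
  classical
  set B := A / dunklVol lam (Metric.ball x₀ δ₀) ^ (1 / p) with hBdef
  set m := h.measurable.mk a with hm
  have hmm : Measurable m := h.measurable.stronglyMeasurable_mk.measurable
  -- Cutting off to this set makes the size and support conditions hold everywhere, changing the
  -- function only on a null set.
  set S : Set ℝ := Metric.ball x₀ δ₀ ∩ {t | ‖m t‖ ≤ B} with hS
  have hSm : MeasurableSet S := measurableSet_ball.inter (measurableSet_le hmm.norm measurable_const)
  have hae : ∀ᵐ t, ‖a t‖ ≤ B := by
    have h1 := h.size
    rw [eLpNorm_exponent_top] at h1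
    filter_upwards [ae_le_eLpNormEssSup (f := a) (μ := volume)] with t ht
    have h2 := ht.trans h1
    rw [← ofReal_norm] at h2
    exact (ENNReal.ofReal_le_ofReal_iff hB).1 h2
  refine ⟨S.indicator m, hmm.indicator hSm, ?_, fun t => ?_, fun t ht => ?_⟩
  · filter_upwards [hae, h.support, h.measurable.ae_eq_mk] with t h1 h2 h3
    by_cases ht : t ∈ Metric.ball x₀ δ₀
    · rw [Set.indicator_of_mem]
      · exact h3
      · refine ⟨ht, ?_⟩
        change ‖m t‖ ≤ B
        rw [hm, ← h3]
        exact h1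
    · rw [Set.indicator_of_notMem fun hmem => ht hmem.1]
      exact h2 ht
  · by_cases ht : t ∈ S
    · rw [Set.indicator_of_mem ht]; exact ht.2
    · rw [Set.indicator_of_notMem ht, norm_zero]; exact hB
  · exact Set.indicator_of_notMem (fun hmem => ht hmem.1) _

theorem conjPoissonIntegral_congr_ae {lam y x : ℝ} {a b : ℝ → ℂ} (h : a =ᵐ[volume] b) :
    conjPoissonIntegral lam a y x = conjPoissonIntegral lam b y x := by
  unfold conjPoissonIntegral
  congr 1
  refine integral_congr_ae ?_
  filter_upwards [h] with t ht
  rw [ht]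

theorem integral_pow_mul_scale_eq_zero {lam s : ℝ} (hs : s ≠ 0) {b : ℝ → ℂ} {k : ℕ}
    (h : ∫ t : ℝ, (t : ℂ) ^ k * b t * ((|t| ^ (2 * lam) : ℝ) : ℂ) = 0) :
    ∫ t : ℝ, (t : ℂ) ^ k * (b (s * t) * ((|t| ^ (2 * lam) : ℝ) : ℂ)) = 0 := by
  have h1 := Measure.integral_comp_mul_left
    (fun t : ℝ => (t : ℂ) ^ k * b t * ((|t| ^ (2 * lam) : ℝ) : ℂ)) s
  rw [h, smul_zero] at h1
  have hsc : (s : ℂ) ≠ 0 := by exact_mod_cast hs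
  have hsp : (((|s| ^ (2 * lam) : ℝ)) : ℂ) ≠ 0 := by
    exact_mod_cast (Real.rpow_pos_of_pos (abs_pos.2 hs) _).ne'
  have h2 : (s : ℂ) ^ k * (((|s| ^ (2 * lam) : ℝ)) : ℂ) *
      ∫ t : ℝ, (t : ℂ) ^ k * (b (s * t) * ((|t| ^ (2 * lam) : ℝ) : ℂ)) = 0 := by
    rw [← integral_const_mul, ← h1]
    congr 1; ext t
    rw [abs_mul, Real.mul_rpow (abs_nonneg _) (abs_nonneg _)]
    push_cast
    ring
  exact (mul_eq_zero.1 h2).resolve_left (mul_ne_zero (pow_ne_zero _ hsc) hsp)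

/-! ### The decay exponent, the atom constant and the theorem. -/

/-- From `N + 1 > (2λ+1)(1-p)/p` one gets `(N+1)p > (2λ+1)(1-p)`; adding `p` to both sides gives the
claim. -/
theorem one_lt_floor_exponent {lam p : ℝ} (hp : 0 < p) :
    1 < (⌊(2 * lam + 1) * ((1 - p) / p)⌋₊ + 2 : ℕ) * p - 2 * lam * (1 - p) := by
  have h := Nat.lt_floor_add_one ((2 * lam + 1) * ((1 - p) / p))
  rw [← mul_div_assoc, div_lt_iff₀ hp, mul_div_assoc] at h
  push_cast
  linarith

/-- The `p`-th power turns `V^(-1/p)` into `1/V`, and `s^(2λ) δ` is controlled by `V`. -/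
theorem atom_constant_bound {lam p A V s δ : ℝ} (hp : 0 < p) (hA : 0 < A)
    (hδ : 0 < δ) (hs : 0 < s) (hV : (s / 2) ^ (2 * lam) * (2 * δ) ≤ V) :
    s ^ (2 * lam) * ((A / V ^ (1 / p) * (3 / 2) ^ (2 * lam)) ^ p * δ) ≤
      A ^ p * ((3 / 2) ^ (2 * lam)) ^ p * 2 ^ (2 * lam) := by
  have hV0 : 0 < V := lt_of_lt_of_le (by positivity) hV
  have e1 : (A / V ^ (1 / p)) ^ p = A ^ p / V := by
    rw [Real.div_rpow hA.le (by positivity), ← Real.rpow_mul hV0.le, one_div_mul_cancel hp.ne',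
      Real.rpow_one]
  rw [Real.mul_rpow (by positivity) (by positivity), e1]
  have h2 : s ^ (2 * lam) * δ ≤ 2 ^ (2 * lam) * V := by
    rw [Real.div_rpow hs.le zero_le_two] at hV
    have h3 : 0 < (2 : ℝ) ^ (2 * lam) := by positivity
    have h4 : 0 < s ^ (2 * lam) * δ := by positivity
    have h5 : s ^ (2 * lam) / 2 ^ (2 * lam) * (2 * δ) * 2 ^ (2 * lam) =
        2 * (s ^ (2 * lam) * δ) := by field_simp
    nlinarith
  calc _ = A ^ p * ((3 / 2) ^ (2 * lam)) ^ p * ((s ^ (2 * lam) * δ) / V) := by ring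
    _ ≤ A ^ p * ((3 / 2) ^ (2 * lam)) ^ p * 2 ^ (2 * lam) := by
      gcongr
      rwa [div_le_iff₀ hV0]

theorem mainTheorem5 (lam p : ℝ) (hlam : 0 < lam)
    (hp : 2 * lam / (2 * lam + 1) < p) (hp1 : p ≤ 1) (A : ℝ) (hA : 0 < A) :
    ∃ C : ℝ, 0 < C ∧ ∀ (κ : ℕ) (a : ℝ → ℂ), IsDunklAtom lam p A κ a → ∀ y : ℝ, 0 < y →
      Integrable (fun x : ℝ => ‖conjPoissonIntegral lam a y x‖ ^ p * |x| ^ (2 * lam)) volume ∧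
      ∫ x : ℝ, ‖conjPoissonIntegral lam a y x‖ ^ p * |x| ^ (2 * lam) ≤ C := by
  have hp0 : 0 < p := lt_trans (by positivity) hp
  obtain ⟨K, hK, hcore⟩ :=
    exists_integral_reducedIntegral_le hlam hp0 hp1 (one_lt_floor_exponent (lam := lam) hp0)
  set c := |dunklConst lam * reducedConst lam| with hc
  have hc0 : 0 ≤ c := abs_nonneg _
  -- The `+ 1` secures positivity, since `c` is only known to be nonnegative.
  refine ⟨c ^ p * K * (A ^ p * ((3 / 2) ^ (2 * lam)) ^ p * 2 ^ (2 * lam)) + 1, by positivity,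
    fun κ a ⟨s, δ, ha⟩ y hy => ?_⟩
  have hδ := ha.radius_pos
  have hδs := ha.radius_lt
  have hs : s ≠ 0 := by
    rintro rfl
    simp only [zero_div, abs_zero] at hδs
    linarith
  have hsp : 0 < |s| := abs_pos.2 hs
  have hV := dunklVol_ball_ge hlam hδ hδs
  rw [abs_div, abs_of_pos (zero_lt_two' ℝ)] at hδs
  set V := dunklVol lam (Metric.ball s δ) with hVdef
  have hV0 : 0 < V := lt_of_lt_of_le (by positivity) hV
  have hB : 0 < A / V ^ (1 / p) := by positivity
  obtain ⟨b, hbm, hab, hbB, hbs⟩ := ha.exists_representative hB.le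
  rw [← hVdef] at hbB
  set f : ℝ → ℂ := fun t => b (s * t) * ((|t| ^ (2 * lam) : ℝ) : ℂ) with hf
  have hd2 : δ / |s| < 1 / 2 := by rw [div_lt_iff₀ hsp]; linarith
  have hfm : Measurable f := by
    refine (hbm.comp (measurable_const_mul s)).mul (Complex.measurable_ofReal.comp ?_)
    fun_prop
  have hfs : ∀ t ∉ Metric.ball 1 (δ / |s|), f t = 0 := fun t ht => by
    have : s * t ∉ Metric.ball s δ := fun hmem => ht (by
      rw [Metric.mem_ball, Real.dist_eq] at hmem ⊢
      rw [lt_div_iff₀ hsp, ← abs_mul]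
      rwa [show (t - 1) * s = s * t - s by ring])
    simp [hf, hbs _ this]
  have hfB : ∀ t, ‖f t‖ ≤ A / V ^ (1 / p) * (3 / 2) ^ (2 * lam) := fun t => by
    by_cases ht : t ∈ Metric.ball 1 (δ / |s|)
    · have ht1 := abs_lt.1 (show |t - 1| < δ / |s| by simpa [Real.dist_eq] using ht)
      rw [hf, norm_mul, Complex.norm_real, Real.norm_of_nonneg (by positivity)]
      have : |t| ≤ 3 / 2 := abs_le.2 ⟨by linarith, by linarith⟩
      have := hbB (s * t)
      gcongr
    · rw [hfs t ht, norm_zero]; positivity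
  have hmom : ∀ k ≤ 2 * ⌊(2 * lam + 1) * ((1 - p) / p)⌋₊, ∫ t : ℝ, (t : ℂ) ^ k * f t = 0 :=
    fun k hk => by
      refine integral_pow_mul_scale_eq_zero hs ?_
      rw [← ha.moments k (hk.trans ha.order)]
      refine integral_congr_ae ?_
      filter_upwards [hab] with t ht
      rw [ht]
  -- The factor `(3/2)^(2λ)` bounds the weight absorbed into `f`, because `|t| ≤ 3/2` on its
  -- support.
  obtain ⟨hi, hle⟩ := hcore (y / |s|) (δ / |s|) (A / V ^ (1 / p) * (3 / 2) ^ (2 * lam)) f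
    (by positivity) (by positivity) hd2 (by positivity) hfm hfB hfs hmom
  set g : ℝ → ℝ := fun x => ‖conjPoissonIntegral lam a y x‖ ^ p * |x| ^ (2 * lam) with hg
  have hscale : (fun x => g (s * x)) =ᵐ[volume] fun x => c ^ p * |s| ^ (2 * lam) *
      (‖reducedIntegral lam (y / |s|) f x‖ ^ p * |x| ^ (2 * lam)) := by
    filter_upwards [compl_mem_ae_iff.2 (measure_singleton (μ := (volume : Measure ℝ)) 0)] with x hx
    have h1 := norm_conjPoissonIntegral_scale (lam := lam) (div_pos hy hsp) hs hx b
    rw [mul_div_cancel₀ y hsp.ne'] at h1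
    simp only [hg]
    rw [conjPoissonIntegral_congr_ae hab, h1, Real.mul_rpow hc0 (norm_nonneg _), abs_mul s x,
      Real.mul_rpow hsp.le (abs_nonneg x)]
    ring
  have hgi : Integrable g := by
    rw [← integrable_comp_mul_left_iff g hs]
    exact (hi.const_mul _).congr hscale.symm
  refine ⟨hgi, ?_⟩
  have h1 := Measure.integral_comp_mul_left g s
  rw [integral_congr_ae hscale, integral_const_mul, abs_inv, smul_eq_mul] at h1
  have h2 : ∫ x, g x = |s| * (c ^ p * |s| ^ (2 * lam) *
      ∫ x, ‖reducedIntegral lam (y / |s|) f x‖ ^ p * |x| ^ (2 * lam)) := by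
    rw [h1]; field_simp
  rw [h2]
  calc _ ≤ |s| * (c ^ p * |s| ^ (2 * lam) *
        (K * (A / V ^ (1 / p) * (3 / 2) ^ (2 * lam)) ^ p * (δ / |s|))) := by gcongr
    _ = c ^ p * K * (|s| ^ (2 * lam) *
        ((A / V ^ (1 / p) * (3 / 2) ^ (2 * lam)) ^ p * δ)) := by field_simp
    _ ≤ c ^ p * K * (A ^ p * ((3 / 2) ^ (2 * lam)) ^ p * 2 ^ (2 * lam)) :=
        mul_le_mul_of_nonneg_left (atom_constant_bound hp0 hA hδ hsp hV) (by positivity)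
    _ ≤ _ := by linarith
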